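/- Let $N\ge 1$ and let $(\Omega,\mathcal F,\mathbb P)$ be a probability space carrying i.i.d. real random variables $U_1,U_2,\dots\ge 0$ (loss amounts) and i.i.d. random variables $\tau_1,\tau_2,\dots$ with values in $\{1,\dots,N\}$ almost surely (default times), the two sequences being independent of each other. Put $p_j=\mathbb P(\tau_1=j)$ for $1\le j\le N$ (so $\sum_j p_j=1$; some $p_j$ may vanish), and let $L_n(t)=\sum_{k=1}^n U_k 1_{\{\tau_k\le t\}}$. Write $\Lambda_U(\theta)=\log\mathbb E\,e^{\theta U_1}\in(-\infty,\infty]$ and $\Lambda_U^\star(x)=\sup_{\theta\in\mathbb R}(\theta x-\Lambda_U(\theta))$. Let $\Phi=\{\varphi\in\mathbb R^N:\varphi_i\ge 0,\ \sum_{i=1}^N\varphi_i=1\}$, and let $\mathbb R^N_\le=\{x\in\mathbb R^N: 0\le x_1\le\dots\le x_N\}$ carry the topology of the supremum norm. Assume the following. For all $\varphi\in\Phi$ and all sequences $(\varphi^n)$ in $\Phi$ with $\varphi^n\to\varphi$, with $\psi_i=\sum_{j\le i}\varphi_j$ and $\psi^n_i=\sum_{j\le i}\varphi^n_j$, the laws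 $\mu_n$ of $\bigl(\frac1n\sum_{k=1}^{\lfloor n\psi_i\rfloor}U_k\bigr)_{i=1}^N$ and $\nu_n$ of $\bigl(\frac1n\sum_{k=1}^{\lfloor n\psi^n_i\rfloor}U_k\bigr)_{i=1}^N$ are exponentially equivalent on $(\mathbb R^N,\|\cdot\|_\infty)$; that is, for each $n$ there are random vectors $Y_n\sim\mu_n$ and $Z_n\sim\nu_n$ on a common probability space such that $\limsup_{n\to\infty}\frac1n\log\mathbb P(\|Y_n-Z_n\|_\infty\ge\delta)=-\infty$ for every $\delta>0$. Then the average loss process $\bigl(L_n(1)/n,\dots,L_n(N)/n\bigr)$ satisfies the large deviation principle in $\mathbb R^N_\le$ with the rate function $$I_{U,p}(x)=\inf_{\varphi\in\Phi}\ \sum_{i=1}^N\varphi_i\left(\log\frac{\varphi_i}{p_i}+\Lambda_U^\star\!\left(\frac{\Delta x_i}{\varphi_i}\right)\right),\qquad \Delta x_i=x_i-x_{i-1},\quad x_0=0,$$ where a summand with $\varphi_i=0$ is read as $0$ if $\Delta x_i=0$ and as $+\infty$ if $\Delta x_i>0$, and a summand with $p_i=0<\varphi_i$ is read as $+\infty$.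 That is, $I_{U,p}:\mathbb R^N_\le\to[0,\infty]$ is lower semicontinuous, and for every closed $F\subseteq\mathbb R^N_\le$ and every open $G\subseteq\mathbb R^N_\le$ $$\limsup_{n\to\infty}\tfrac1n\log\mathbb P\bigl(L_n(\cdot)/n\in F\bigr)\le-\inf_{x\in F}I_{U,p}(x),\qquad \liminf_{n\to\infty}\tfrac1n\log\mathbb P\bigl(L_n(\cdot)/n\in G\bigr)\ge-\inf_{x\in G}I_{U,p}(x).$$ -/

import Mathlib

open MeasureTheory ProbabilityTheory Filter Topology
open scoped ENNReal

noncomputable section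

namespace LossLDP

/-! ### Large deviations -/

/-- A rate function: a lower semicontinuous function with values in `[0, ∞]`. -/
structure IsRateFunction {X : Type*} [TopologicalSpace X] (I : X → EReal) : Prop where
  nonneg : ∀ x, 0 ≤ I x
  lowerSemicontinuous : LowerSemicontinuous I

/-- The large deviation principle, with speed `n`, for a sequence of measures. Logarithms are
extended-real valued, with `log 0 = -∞`. -/
structure SatisfiesLDP {X : Type*} [TopologicalSpace X] [MeasurableSpace X]
    (μ : ℕ → Measure X) (I : X → EReal) : Prop where
  rate : IsRateFunction I
  upper : ∀ F : Set X, IsClosed F →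
    limsup (fun n : ℕ => ENNReal.log (μ n F) / (n : EReal)) atTop ≤ -⨅ x ∈ F, I x
  lower : ∀ G : Set X, IsOpen G →
    -⨅ x ∈ G, I x ≤ liminf (fun n : ℕ => ENNReal.log (μ n G) / (n : EReal)) atTop

/-- Exponential equivalence of two sequences of probability measures on a metric space.
The measure `γ n` is the joint law of the pair `(Y n, Z n)` of random variables with marginal
laws `μ n` and `ν n`. -/
def ExpEquivalent {X : Type*} [PseudoMetricSpace X] [MeasurableSpace X]
    (μ ν : ℕ → Measure X) : Prop :=
  ∃ γ : ℕ → Measure (X × X),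
    (∀ n, (γ n).map Prod.fst = μ n) ∧ (∀ n, (γ n).map Prod.snd = ν n) ∧
    ∀ δ : ℝ, 0 < δ →
      limsup (fun n : ℕ => ENNReal.log (γ n {z | δ ≤ dist z.1 z.2}) / (n : EReal)) atTop = ⊥

/-- The logarithmic moment generating function `θ ↦ log E[exp (θ X)]`, possibly `+∞`. -/
def logMGF {Ω : Type*} [MeasurableSpace Ω] (P : Measure Ω) (X : Ω → ℝ) (θ : ℝ) : EReal :=
  ENNReal.log (∫⁻ ω, ENNReal.ofReal (Real.exp (θ * X ω)) ∂P)

/-- The Fenchel–Legendre transform of the random variable `X`. -/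
def fenchelLegendre {Ω : Type*} [MeasurableSpace Ω] (P : Measure Ω) (X : Ω → ℝ) (x : ℝ) : EReal :=
  ⨆ θ : ℝ, ((θ * x : ℝ) : EReal) - logMGF P X θ

/-! ### Paths on the grid

The grid `{1, …, N}` is indexed by `Fin N`: the index `i` stands for the time `i + 1`. -/

/-- The space of nonnegative nondecreasing paths on `{1, …, N}`, with the topology induced by the
supremum norm. -/
abbrev PathSpace (N : ℕ) : Type :=
  {x : Fin N → ℝ // (∀ i, 0 ≤ x i) ∧ Monotone x}

/-- The increment of a path at the `i`-th grid point; the path starts from the value `0`. -/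
def increment {N : ℕ} (x : Fin N → ℝ) (i : Fin N) : ℝ :=
  x i - if (i : ℕ) = 0 then 0 else x ⟨(i : ℕ) - 1, lt_of_le_of_lt (Nat.sub_le _ _) i.isLt⟩

/-- The cumulative distribution function of a probability vector on the grid. -/
def cumul {N : ℕ} (φ : Fin N → ℝ) (i : Fin N) : ℝ := ∑ j ∈ Finset.Iic i, φ j

/-! ### The loss process

The obligors `1, 2, …` are indexed by `0, 1, …`. -/

/-- The cumulative loss at time `t` of the portfolio of the first `n` obligors. -/
def loss {Ω : Type*} (U : ℕ → Ω → ℝ) (τ : ℕ → Ω → ℕ) (n t : ℕ) (ω : Ω) : ℝ :=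
  ∑ k ∈ Finset.range n, U k ω * if τ k ω ≤ t then 1 else 0

/-- The average loss process on the grid `{1, …, N}`, as a random element of the path space. -/
def avgLossPath {Ω : Type*} (N : ℕ) (U : ℕ → Ω → ℝ) (τ : ℕ → Ω → ℕ)
    (hU : ∀ k ω, 0 ≤ U k ω) (n : ℕ) (ω : Ω) : PathSpace N :=
  ⟨fun i => loss U τ n ((i : ℕ) + 1) ω / n, by
    have key : ∀ s t : ℕ, s ≤ t → loss U τ n s ω ≤ loss U τ n t ω := by
      intro s t hst
      refine Finset.sum_le_sum fun k _ => mul_le_mul_of_nonneg_left ?_ (hU k ω)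
      by_cases h : τ k ω ≤ s
      · simp [h, h.trans hst]
      · simp only [h, if_false]
        split_ifs <;> norm_num
    refine ⟨fun i => div_nonneg (Finset.sum_nonneg fun k _ => mul_nonneg (hU k ω) ?_)
      n.cast_nonneg, fun i j hij => div_le_div_of_nonneg_right (key _ _ ?_) n.cast_nonneg⟩
    · split_ifs <;> norm_num
    · have : (i : ℕ) ≤ j := hij
      lia⟩

/-- The distribution of the default time on the grid. -/
def defaultDist {Ω : Type*} [MeasurableSpace Ω] (P : Measure Ω) (N : ℕ) (τ : Ω → ℕ)
    (i : Fin N) : ℝ≥0∞ :=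
  P {ω | τ ω = (i : ℕ) + 1}

/-- The vector of rounded partial sums `(1/n) ∑_{k ≤ [n ψ_i]} U_k`, `ψ` being the cumulative
distribution function of `φ`. -/
def roundedSums {Ω : Type*} {N : ℕ} (U : ℕ → Ω → ℝ) (φ : Fin N → ℝ) (n : ℕ) (ω : Ω) : Fin N → ℝ :=
  fun i => (∑ k ∈ Finset.range ⌊(n : ℝ) * cumul φ i⌋₊, U k ω) / n

/-- The assumption on the loss amounts: whenever `φ^n → φ` in the simplex, the laws of the rounded
partial sums for `φ` and for `φ^n` are exponentially equivalent on `ℝ^N` with the supremum norm. -/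
def RoundedSumsExpEquivalent {Ω : Type*} [MeasurableSpace Ω] (P : Measure Ω) (N : ℕ)
    (U : ℕ → Ω → ℝ) : Prop :=
  ∀ φ ∈ stdSimplex ℝ (Fin N), ∀ φs : ℕ → Fin N → ℝ, (∀ n, φs n ∈ stdSimplex ℝ (Fin N)) →
    Tendsto φs atTop (𝓝 φ) →
    ExpEquivalent (fun n => P.map (roundedSums U φ n)) (fun n => P.map (roundedSums U (φs n) n))

/-! ### The rate function -/

/-- The summand `φ (log (φ / p) + Λ* (d / φ))`, with the usual conventions: for `φ = 0` it is `0`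
if `d = 0` and `+∞` otherwise; for `p = 0 < φ` it is `+∞`. -/
def rateTerm (Λstar : ℝ → EReal) (p : ℝ≥0∞) (φ d : ℝ) : EReal :=
  if φ = 0 then (if d = 0 then 0 else ⊤)
  else (φ : EReal) * (ENNReal.log (ENNReal.ofReal φ / p) + Λstar (d / φ))

/-- The rate function `I_{U,p}` of the average loss process. -/
def rateFunction {Ω : Type*} [MeasurableSpace Ω] {N : ℕ} (P : Measure Ω) (X : Ω → ℝ)
    (p : Fin N → ℝ≥0∞) (x : PathSpace N) : EReal :=
  ⨅ φ ∈ stdSimplex ℝ (Fin N), ∑ i, rateTerm (fenchelLegendre P X) (p i) (φ i) (increment x.1 i)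

end LossLDP

end

/-! The path is a continuous function of its increments. The increment at grid point `i` is the
average over the obligors of `1_{τ = i} U`, and it is studied jointly with the default frequency,
the average of `1_{τ = i}`. The pairs `(U_k, τ_k)` are i.i.d., so this is a Cramér problem for the
pair (frequencies `φ`, increments `d`), with rate `∑ rateTerm`. Since `φ` ranges over the compact
simplex, taking the infimum over `φ` yields `I_{U,p}`.

Upper bound. A summand is the supremum over `(η, θ)` of `ηφ + θd + φ - p e^η M(θ)`, where `M` is the
moment generating function of `U` (`le_rateTerm`, `exists_lt_of_lt_rateTerm`). Each dual functional
is continuous in `(x, φ)`, and exponential Chebyshev bounds the probability that it exceeds `a`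
(`measure_sum_gt_le`). Finitely many such sets cover `F × simplex` for compact `F`; the same
functionals give lower semicontinuity. A positive exponential moment extends the bound to closed
`F`.

Lower bound. If `Λ*(x) < L`, some bounded, boundedly supported density recentres `U` at `x` and is
dominated by `e^{b + θu}` with `b + θx ≤ L` (`exists_tilt`); no moment assumption is needed, because
the tilting is done after truncation. Gluing these densities over the grid points gives a weight `W`
of mass one. Under the product weight, Chebyshev concentrates frequencies and increments at `(φ,
d)`, and near that point the product weight is at most `e^{nr}`, so the original probability is at
least about `e^{-nr}` (`eventually_le_measure_near`).

Role of the exponential equivalence. At `φ_i = 0` the rate jumps to `+∞` as soon as `d_i > 0`, and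
the dual formula reproduces this only if the moments of `U` are finite. For `N ≥ 2`, comparing `φ =
(0, 1, 0, …)` with `φ^n = (1/n, 1 - 1/n, 0, …)` compares `0` with `U_1 / n`, so `P(U ≥ n)` decays
superexponentially and all exponential moments are finite (`emgf_ne_top_of_expEquivalent`). For `N =
1` the simplex is one point with `φ = 1` and the problem never arises; if moreover `U` has no
positive exponential moment, `Λ*` is at most any given `ε > 0` far out, so the upper bound for
unbounded closed sets is trivial. -/

namespace LossLDP

/-! ### Independence of the pairs -/

section Independence

variable {Ω : Type*} [MeasurableSpace Ω] {P : Measure Ω}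

/-- Two independent sequences of independent random variables give a sequence of independent
pairs. -/
theorem iIndepFun_prodMk [IsProbabilityMeasure P] {α β : Type*} [MeasurableSpace α]
    [MeasurableSpace β] {X : ℕ → Ω → α} {Y : ℕ → Ω → β} (hX : ∀ k, Measurable (X k))
    (hY : ∀ k, Measurable (Y k)) (hXi : iIndepFun X P) (hYi : iIndepFun Y P)
    (hXY : IndepFun (fun ω k => X k ω) (fun ω k => Y k ω) P) :
    iIndepFun (fun k ω => (X k ω, Y k ω)) P := by
  have hm : ∀ k, Measurable (fun ω => (X k ω, Y k ω)) := fun k => (hX k).prodMk (hY k)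
  have hXYk : ∀ k, IndepFun (X k) (Y k) P := fun k =>
    hXY.comp (measurable_pi_apply k) (measurable_pi_apply k)
  rw [iIndepFun_iff_iIndep]
  refine iIndepSets.iIndep (fun k => (hm k).comap_le)
    (fun k => {S | ∃ A B, MeasurableSet A ∧ MeasurableSet B ∧ S = X k ⁻¹' A ∩ Y k ⁻¹' B})
    ?_ ?_ ?_
  · rintro k _ ⟨A, B, hA, hB, rfl⟩ _ ⟨A', B', hA', hB', rfl⟩ -
    exact ⟨A ∩ A', B ∩ B', hA.inter hA', hB.inter hB', by ext; simp; tauto⟩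
  · intro k
    rw [← generateFrom_prod, MeasurableSpace.comap_generateFrom]
    congr 1
    ext S
    constructor
    · rintro ⟨_, ⟨A, hA, B, hB, rfl⟩, rfl⟩
      exact ⟨A, B, hA, hB, rfl⟩
    · rintro ⟨A, B, hA, hB, rfl⟩
      exact ⟨_, ⟨A, hA, B, hB, rfl⟩, rfl⟩
  · rw [iIndepSets_iff]
    intro s f hf
    choose! A B hA hB hAB using hf
    have h1 : (⋂ i ∈ s, f i) = (⋂ i ∈ s, X i ⁻¹' A i) ∩ ⋂ i ∈ s, Y i ⁻¹' B i := by
      rw [Set.iInter₂_congr hAB]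
      ext; simp; grind
    have h2 : P ((⋂ i ∈ s, X i ⁻¹' A i) ∩ ⋂ i ∈ s, Y i ⁻¹' B i)
        = P (⋂ i ∈ s, X i ⁻¹' A i) * P (⋂ i ∈ s, Y i ⁻¹' B i) := by
      have := hXY.measure_inter_preimage_eq_mul
        (⋂ i ∈ s, {v | v i ∈ A i}) (⋂ i ∈ s, {v | v i ∈ B i})
        (s.measurableSet_biInter fun i hi => measurable_pi_apply i (hA i hi))
        (s.measurableSet_biInter fun i hi => measurable_pi_apply i (hB i hi))
      simp only [Set.preimage_iInter] at this
      exact this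
    rw [h1, h2, hXi.measure_inter_preimage_eq_mul s (fun i hi => hA i hi),
      hYi.measure_inter_preimage_eq_mul s (fun i hi => hB i hi), ← Finset.prod_mul_distrib]
    refine Finset.prod_congr rfl fun i hi => ?_
    rw [hAB i hi, (hXYk i).measure_inter_preimage_eq_mul _ _ (hA i hi) (hB i hi)]

/-- Pairs of independent random variables with the same marginal laws have the same law. -/
theorem identDistrib_prodMk [IsProbabilityMeasure P] {α β : Type*} [MeasurableSpace α]
    [MeasurableSpace β] {X X' : Ω → α} {Y Y' : Ω → β} (hX : IdentDistrib X X' P P)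
    (hY : IdentDistrib Y Y' P P) (hXY : IndepFun X Y P) (hXY' : IndepFun X' Y' P) :
    IdentDistrib (fun ω => (X ω, Y ω)) (fun ω => (X' ω, Y' ω)) P P where
  aemeasurable_fst := hX.aemeasurable_fst.prodMk hY.aemeasurable_fst
  aemeasurable_snd := hX.aemeasurable_snd.prodMk hY.aemeasurable_snd
  map_eq := by
    rw [(indepFun_iff_map_prod_eq_prod_map_map hX.aemeasurable_fst hY.aemeasurable_fst).1 hXY,
      (indepFun_iff_map_prod_eq_prod_map_map hX.aemeasurable_snd hY.aemeasurable_snd).1 hXY',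
      hX.map_eq, hY.map_eq]

end Independence

/-! ### A weighted Chebyshev inequality -/

section Weighted

variable {Ω E : Type*} [MeasurableSpace Ω] [MeasurableSpace E] {P : Measure Ω}
  {V : ℕ → Ω → E} {W Y : E → ℝ}

/-- The first factor depends only on the first `n` variables. The exponent `j` serves the moments of
order 0, 1 and 2 at once. -/
theorem indepFun_weighted (hV : ∀ k, Measurable (V k)) (hVi : iIndepFun V P)
    (hW : Measurable W) (hY : Measurable Y) (j n : ℕ) {g : E → ℝ} (hg : Measurable g) :
    IndepFun (fun ω => (∏ k ∈ Finset.range n, W (V k ω)) * (∑ k ∈ Finset.range n, Y (V k ω)) ^ j)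
      (fun ω => g (V n ω)) P := by
  have h := hVi.indepFun_finset (Finset.range n) {n} (by simp) hV
  have := h.comp
    (φ := fun v => (∏ k, W (v k)) * (∑ k, Y (v k)) ^ j)
    (ψ := fun v : (({n} : Finset ℕ) → E) => g (v ⟨n, Finset.mem_singleton_self n⟩))
    (by fun_prop) (by fun_prop)
  convert this using 1
  · ext ω
    simp only [Function.comp_apply]
    rw [← Finset.prod_coe_sort, ← Finset.sum_coe_sort]
  · rfl

/-- The first moments of a sum of independent, identically distributed random variables under a
product weight. -/
theorem integral_weighted [IsProbabilityMeasure P] (hV : ∀ k, Measurable (V k)) (hVi : iIndepFun V P)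
    (hVd : ∀ k, IdentDistrib (V k) (V 0) P P) (hW : Measurable W) (hY : Measurable Y)
    (i0 : Integrable (fun ω => W (V 0 ω)) P) (i1 : Integrable (fun ω => W (V 0 ω) * Y (V 0 ω)) P)
    (i2 : Integrable (fun ω => W (V 0 ω) * Y (V 0 ω) ^ 2) P)
    (h0 : ∫ ω, W (V 0 ω) ∂P = 1) (h1 : ∫ ω, W (V 0 ω) * Y (V 0 ω) ∂P = 0) (n : ℕ) :
    (Integrable (fun ω => ∏ k ∈ Finset.range n, W (V k ω)) P ∧
      ∫ ω, ∏ k ∈ Finset.range n, W (V k ω) ∂P = 1) ∧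
    (Integrable (fun ω => (∏ k ∈ Finset.range n, W (V k ω)) * ∑ k ∈ Finset.range n, Y (V k ω)) P ∧
      ∫ ω, (∏ k ∈ Finset.range n, W (V k ω)) * ∑ k ∈ Finset.range n, Y (V k ω) ∂P = 0) ∧
    (Integrable
        (fun ω => (∏ k ∈ Finset.range n, W (V k ω)) * (∑ k ∈ Finset.range n, Y (V k ω)) ^ 2) P ∧
      ∫ ω, (∏ k ∈ Finset.range n, W (V k ω)) * (∑ k ∈ Finset.range n, Y (V k ω)) ^ 2 ∂P
        = n * ∫ ω, W (V 0 ω) * Y (V 0 ω) ^ 2 ∂P) := by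
  have transfer : ∀ g : E → ℝ, Measurable g → Integrable (fun ω => g (V 0 ω)) P → ∀ k,
      Integrable (fun ω => g (V k ω)) P ∧ ∫ ω, g (V k ω) ∂P = ∫ ω, g (V 0 ω) ∂P := fun g hg hi k =>
    ⟨((hVd k).comp hg).integrable_iff.2 hi, ((hVd k).comp hg).integral_eq⟩
  induction n with
  | zero => simp
  | succ n ih =>
    obtain ⟨⟨a, a'⟩, ⟨b, b'⟩, ⟨c, c'⟩⟩ := ih
    obtain ⟨t0, t0'⟩ := transfer W hW i0 n
    obtain ⟨t1, t1'⟩ := transfer (fun e => W e * Y e) (by fun_prop) i1 n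
    obtain ⟨t2, t2'⟩ := transfer (fun e => W e * Y e ^ 2) (by fun_prop) i2 n
    have m1 : Measurable fun e => W e * Y e := by fun_prop
    have m2 : Measurable fun e => W e * Y e ^ 2 := by fun_prop
    have I : ∀ j {g : E → ℝ}, Measurable g → IndepFun (fun ω =>
        (∏ k ∈ Finset.range n, W (V k ω)) * (∑ k ∈ Finset.range n, Y (V k ω)) ^ j)
        (fun ω => g (V n ω)) P := fun j => indepFun_weighted hV hVi hW hY j n
    have prod : ∀ {A B : Ω → ℝ}, IndepFun A B P → Integrable A P → Integrable B P →
        Integrable (fun ω => A ω * B ω) P ∧ ∫ ω, A ω * B ω ∂P = (∫ ω, A ω ∂P) * ∫ ω, B ω ∂P :=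
      fun h hA hB => ⟨h.integrable_mul hA hB,
        h.integral_fun_mul_eq_mul_integral hA.aestronglyMeasurable hB.aestronglyMeasurable⟩
    have I0 : ∀ {g : E → ℝ}, Measurable g →
        IndepFun (fun ω => ∏ k ∈ Finset.range n, W (V k ω)) (fun ω => g (V n ω)) P := by
      intro g hg; simpa using I 0 hg
    have I1 : ∀ {g : E → ℝ}, Measurable g →
        IndepFun (fun ω => (∏ k ∈ Finset.range n, W (V k ω)) * ∑ k ∈ Finset.range n, Y (V k ω))
          (fun ω => g (V n ω)) P := by
      intro g hg; simpa using I 1 hg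
    obtain ⟨q00, q00'⟩ := prod (I0 hW) a t0
    obtain ⟨q01, q01'⟩ := prod (I0 m1) a t1
    obtain ⟨q02, q02'⟩ := prod (I0 m2) a t2
    obtain ⟨q10, q10'⟩ := prod (I1 hW) b t0
    obtain ⟨q11, q11'⟩ := prod (I1 m1) b t1
    obtain ⟨q20, q20'⟩ := prod (I 2 hW) c t0
    simp only [Finset.prod_range_succ, Finset.sum_range_succ]
    refine ⟨⟨q00, by rw [q00', a', t0', h0, one_mul]⟩, ?_, ?_⟩
    · have e : (fun ω => ((∏ k ∈ Finset.range n, W (V k ω)) * W (V n ω)) *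
          (∑ k ∈ Finset.range n, Y (V k ω) + Y (V n ω)))
          = fun ω => ((∏ k ∈ Finset.range n, W (V k ω)) * ∑ k ∈ Finset.range n, Y (V k ω)) *
              W (V n ω) + (∏ k ∈ Finset.range n, W (V k ω)) * (W (V n ω) * Y (V n ω)) := by
        ext; ring
      rw [e]
      refine ⟨q10.add q01, ?_⟩
      rw [integral_add q10 q01, q10', q01', b', t1', h1]; simp
    -- The cross term integrates to zero by centring, so second moments add up as for a variance.
    · have e : (fun ω => ((∏ k ∈ Finset.range n, W (V k ω)) * W (V n ω)) *
          (∑ k ∈ Finset.range n, Y (V k ω) + Y (V n ω)) ^ 2)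
          = fun ω => ((∏ k ∈ Finset.range n, W (V k ω)) * (∑ k ∈ Finset.range n, Y (V k ω)) ^ 2) *
              W (V n ω) + 2 * (((∏ k ∈ Finset.range n, W (V k ω)) *
              ∑ k ∈ Finset.range n, Y (V k ω)) * (W (V n ω) * Y (V n ω))) +
              (∏ k ∈ Finset.range n, W (V k ω)) * (W (V n ω) * Y (V n ω) ^ 2) := by
        ext; ring
      rw [e]
      have q11c := q11.const_mul 2
      refine ⟨(q20.add q11c).add q02, ?_⟩
      rw [integral_add (by exact q20.add q11c) q02, integral_add q20 q11c, integral_const_mul, q20', q11',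
        q02', a', b', c', t0', t2', h0]
      push_cast; ring

/-- Under a product weight of mass one, the probability of a deviation of size `δ n` is at most
of order `1 / n`. -/
theorem setIntegral_weighted_le [IsProbabilityMeasure P] (hV : ∀ k, Measurable (V k)) (hVi : iIndepFun V P)
    (hVd : ∀ k, IdentDistrib (V k) (V 0) P P) (hW : Measurable W) (hY : Measurable Y)
    (hW0 : ∀ e, 0 ≤ W e)
    (i0 : Integrable (fun ω => W (V 0 ω)) P) (i1 : Integrable (fun ω => W (V 0 ω) * Y (V 0 ω)) P)
    (i2 : Integrable (fun ω => W (V 0 ω) * Y (V 0 ω) ^ 2) P)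
    (h0 : ∫ ω, W (V 0 ω) ∂P = 1) (h1 : ∫ ω, W (V 0 ω) * Y (V 0 ω) ∂P = 0)
    {δ : ℝ} (hδ : 0 < δ) {n : ℕ} (hn : 0 < n) :
    ∫ ω in {ω | δ * n ≤ |∑ k ∈ Finset.range n, Y (V k ω)|}, ∏ k ∈ Finset.range n, W (V k ω) ∂P
      ≤ (∫ ω, W (V 0 ω) * Y (V 0 ω) ^ 2 ∂P) / δ ^ 2 / n := by
  obtain ⟨⟨a, -⟩, -, c, c'⟩ := integral_weighted hV hVi hVd hW hY i0 i1 i2 h0 h1 n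
  have hn' : (0 : ℝ) < n := by exact_mod_cast hn
  set S := {ω | δ * n ≤ |∑ k ∈ Finset.range n, Y (V k ω)|} with hS
  have hSm : MeasurableSet S := measurableSet_le measurable_const (by fun_prop)
  have key : ∀ ω, S.indicator (fun ω => ∏ k ∈ Finset.range n, W (V k ω)) ω ≤
      (δ * n)⁻¹ ^ 2 * ((∏ k ∈ Finset.range n, W (V k ω)) *
        (∑ k ∈ Finset.range n, Y (V k ω)) ^ 2) := by
    intro ω
    have hp : 0 ≤ ∏ k ∈ Finset.range n, W (V k ω) := Finset.prod_nonneg fun k _ => hW0 _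
    by_cases h : ω ∈ S
    · rw [Set.indicator_of_mem h]
      have h2 : (δ * n) ^ 2 ≤ (∑ k ∈ Finset.range n, Y (V k ω)) ^ 2 := by
        rw [← sq_abs (∑ k ∈ Finset.range n, Y (V k ω))]
        exact pow_le_pow_left₀ (by positivity) h 2
      have h3 : 1 ≤ (δ * n)⁻¹ ^ 2 * (∑ k ∈ Finset.range n, Y (V k ω)) ^ 2 := by
        rw [inv_pow, inv_mul_eq_div, one_le_div (by positivity)]; exact h2
      nlinarith
    · rw [Set.indicator_of_notMem h]; positivity
  rw [← integral_indicator hSm]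
  refine (integral_mono (a.indicator hSm) (c.const_mul _) key).trans ?_
  rw [integral_const_mul, c']
  apply le_of_eq
  field_simp

end Weighted

end LossLDP

namespace LossLDP

/-! ### Exponential tilting -/

section Tilting

variable {Ω : Type*} [MeasurableSpace Ω] {P : Measure Ω}

theorem ofReal_exp_le_lintegral_of_fenchelLegendre_le {X : Ω → ℝ} {x L : ℝ}
    (h : fenchelLegendre P X x ≤ L) (θ : ℝ) :
    ENNReal.ofReal (Real.exp (θ * x - L)) ≤ ∫⁻ ω, ENNReal.ofReal (Real.exp (θ * X ω)) ∂P := by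
  have h1 : ((θ * x : ℝ) : EReal) - logMGF P X θ ≤ L := (le_iSup _ θ).trans h
  have h2 : ((θ * x - L : ℝ) : EReal) ≤ logMGF P X θ := by
    revert h1
    induction logMGF P X θ using EReal.rec with
    | bot => intro h1; rw [EReal.coe_sub_bot] at h1; exact absurd h1 (by simp)
    | top => intro _; exact le_top
    | coe y =>
      intro h1
      norm_cast at h1 ⊢
      linarith
  have h3 := EReal.exp_monotone h2
  rwa [logMGF, ENNReal.exp_log, EReal.exp_coe] at h3

/-- For `t ≥ 0` the event `{ε ≤ X}` alone contributes at least `e^{tε} ν(X ≥ ε)`. -/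
theorem tendsto_mgf_atTop {ν : Measure Ω} {X : Ω → ℝ} (hX : Measurable X)
    (hint : ∀ t, Integrable (fun ω => Real.exp (t * X ω)) ν) {ε : ℝ} (hε : 0 < ε)
    (hpos : ν {ω | ε ≤ X ω} ≠ 0) : Tendsto (mgf X ν) atTop atTop := by
  have hfin : IsFiniteMeasure ν := by
    have := hint 0
    simp only [zero_mul, Real.exp_zero] at this
    exact (integrable_const_iff_isFiniteMeasure one_ne_zero).1 this
  have hm : 0 < ν.real {ω | ε ≤ X ω} := ENNReal.toReal_pos hpos (measure_ne_top _ _)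
  have hS : MeasurableSet {ω | ε ≤ X ω} := measurableSet_le measurable_const hX
  have hlim : Tendsto (fun t : ℝ => Real.exp (t * ε) * ν.real {ω | ε ≤ X ω}) atTop atTop :=
    (Real.tendsto_exp_atTop.comp (tendsto_id.atTop_mul_const hε)).atTop_mul_const hm
  refine tendsto_atTop_mono' _ ?_ hlim
  filter_upwards [eventually_ge_atTop 0] with t ht
  calc Real.exp (t * ε) * ν.real {ω | ε ≤ X ω}
      = ∫ ω, {ω | ε ≤ X ω}.indicator (fun _ => Real.exp (t * ε)) ω ∂ν := by
        rw [integral_indicator hS, setIntegral_const, smul_eq_mul, mul_comm]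
    _ ≤ mgf X ν t := by
        refine integral_mono ((integrable_const _).indicator hS) (hint t) fun ω => ?_
        by_cases h : ω ∈ {ω | ε ≤ X ω}
        · rw [Set.indicator_of_mem h]
          exact Real.exp_le_exp.2 (mul_le_mul_of_nonneg_left h ht)
        · rw [Set.indicator_of_notMem h]; positivity

/-- The window is bounded away from `0` to make the moment generating function grow, and bounded
above so that it survives truncation. -/
theorem exists_measure_Icc_ne_zero {X : Ω → ℝ} (h : P {ω | 0 < X ω} ≠ 0) :
    ∃ n : ℕ, P {ω | 1 / ((n : ℝ) + 1) ≤ X ω ∧ X ω ≤ n + 1} ≠ 0 := by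
  by_contra! hn
  refine h (measure_mono_null ?_ (measure_iUnion_null hn))
  intro ω hω
  obtain ⟨a, ha⟩ := exists_nat_one_div_lt (K := ℝ) hω
  obtain ⟨b, hb⟩ := exists_nat_ge (X ω)
  refine Set.mem_iUnion.2 ⟨max a b, ?_, ?_⟩
  · refine le_trans (one_div_le_one_div_of_le (by positivity) ?_) ha.le
    push_cast; gcongr; exact le_max_left _ _
  · push_cast; linarith [le_max_right (a : ℝ) b]

/-- A density for the law of `X` that is bounded and boundedly supported, under which the mean
is zero, and that is dominated by `exp (θ v) / c` for some `θ`. -/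
def HasCenteredTilt (P : Measure Ω) (X : Ω → ℝ) (c : ℝ) : Prop :=
  ∃ (g : ℝ → ℝ) (B θ : ℝ), Measurable g ∧ (∀ v, 0 ≤ g v) ∧ (∀ v, g v ≤ B) ∧
    (∀ v, B < |v| → g v = 0) ∧ ∫ ω, g (X ω) ∂P = 1 ∧ ∫ ω, X ω * g (X ω) ∂P = 0 ∧
    ∀ v, g v ≤ Real.exp (θ * v) / c

theorem HasCenteredTilt.of_neg {X : Ω → ℝ} {c : ℝ} (h : HasCenteredTilt P (fun ω => -X ω) c) :
    HasCenteredTilt P X c := by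
  obtain ⟨g, B, θ, h1, h2, h3, h4, h5, h6, h7⟩ := h
  refine ⟨fun v => g (-v), B, -θ, h1.comp measurable_neg, fun v => h2 _, fun v => h3 _,
    fun v hv => h4 _ (by rwa [abs_neg]), h5, ?_, fun v => ?_⟩
  · simpa [integral_neg] using h6
  · simpa using h7 (-v)

/-- One-sided case: `E e^{-nX}` decreases to `P(X = 0)`, so the lower bound `c` forces an atom at
`0` of mass at least `c`. The density is the normalised indicator of that atom, with `θ = 0`. -/
theorem hasCenteredTilt_of_nonneg [IsProbabilityMeasure P] {X : Ω → ℝ} (hX : Measurable X)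
    {c : ℝ} (hc : 0 < c)
    (h : ∀ θ : ℝ, ENNReal.ofReal c ≤ ∫⁻ ω, ENNReal.ofReal (Real.exp (θ * X ω)) ∂P)
    (h0 : P {ω | X ω < 0} = 0) : HasCenteredTilt P X c := by
  have hS : MeasurableSet {ω | X ω = 0} := hX (measurableSet_singleton 0)
  have hX0 : ∀ᵐ ω ∂P, 0 ≤ X ω := by
    rw [ae_iff]; simpa using h0
  have hlim : Tendsto (fun n : ℕ => ∫⁻ ω, ENNReal.ofReal (Real.exp (-(n : ℝ) * X ω)) ∂P) atTop
      (𝓝 (∫⁻ ω, {ω | X ω = 0}.indicator 1 ω ∂P)) := by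
    refine tendsto_lintegral_of_dominated_convergence (fun _ => 1) (fun n => by fun_prop) ?_
      (by simp) ?_
    · intro n
      filter_upwards [hX0] with ω hω
      rw [ENNReal.ofReal_le_one, Real.exp_le_one_iff]
      have := mul_nonneg n.cast_nonneg hω
      linarith
    · filter_upwards [hX0] with ω hω
      rcases hω.eq_or_lt with h' | h'
      · simp [← h']
      · rw [Set.indicator_of_notMem (by simpa using h'.ne')]
        rw [← ENNReal.ofReal_zero]
        refine ENNReal.tendsto_ofReal (Real.tendsto_exp_atBot.comp ?_)
        have := (tendsto_natCast_atTop_atTop (R := ℝ)).atTop_mul_const h'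
        refine (tendsto_neg_atTop_atBot.comp this).congr fun n => ?_
        simp
  have hle : ENNReal.ofReal c ≤ P {ω | X ω = 0} := by
    have := ge_of_tendsto' hlim fun n => h (-(n : ℝ))
    rwa [lintegral_indicator_one hS] at this
  set a := P.real {ω | X ω = 0} with ha
  have hca : c ≤ a := (ENNReal.ofReal_le_iff_le_toReal (measure_ne_top _ _)).1 hle
  have ha0 : 0 < a := hc.trans_le hca
  refine ⟨Set.indicator {0} fun _ => a⁻¹, a⁻¹, 0, measurable_const.indicator
    (measurableSet_singleton 0), fun v => Set.indicator_nonneg (fun _ _ => by positivity) v,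
    fun v => Set.indicator_le_self' (fun _ _ => by positivity) v, ?_, ?_, ?_, ?_⟩
  · intro v hv
    refine Set.indicator_of_notMem ?_ _
    rintro rfl
    rw [abs_zero] at hv
    exact absurd hv (by simpa using ha0.le)
  · have : (fun ω => Set.indicator {0} (fun _ => a⁻¹) (X ω))
        = {ω | X ω = 0}.indicator fun _ => a⁻¹ := by
      ext ω; simp [Set.indicator]
    rw [this, integral_indicator hS, setIntegral_const, smul_eq_mul, ← ha, mul_inv_cancel₀ ha0.ne']
  · rw [integral_eq_zero_of_ae]
    refine ae_of_all _ fun ω => ?_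
    by_cases h' : X ω = 0 <;> simp [h']
  · intro v
    refine (Set.indicator_le_self' (fun _ _ => by positivity) v).trans ?_
    rw [zero_mul, Real.exp_zero, one_div]
    exact inv_anti₀ hc hca

theorem integrable_exp_mul_restrict_abs_le [IsFiniteMeasure P] {X : Ω → ℝ} (hX : Measurable X)
    (K t : ℝ) : Integrable (fun ω => Real.exp (t * X ω)) (P.restrict {ω | |X ω| ≤ K}) := by
  have hS : MeasurableSet {ω | |X ω| ≤ K} := measurableSet_le hX.abs measurable_const
  refine Integrable.of_bound (by fun_prop) (Real.exp (|t| * K)) ?_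
  filter_upwards [ae_restrict_mem hS] with ω hω
  rw [Real.norm_eq_abs, Real.abs_exp, Real.exp_le_exp]
  calc t * X ω ≤ |t * X ω| := le_abs_self _
    _ = |t| * |X ω| := abs_mul _ _
    _ ≤ |t| * K := mul_le_mul_of_nonneg_left hω (abs_nonneg _)

/-- Mass on both sides of `0`, kept by the truncation at `K`, makes the truncated moment generating
function coercive, hence minimised somewhere. -/
theorem tendsto_mgf_restrict_cocompact [IsFiniteMeasure P] {X : Ω → ℝ} (hX : Measurable X)
    {a b : ℕ} (ha : P {ω | 1 / ((a : ℝ) + 1) ≤ X ω ∧ X ω ≤ a + 1} ≠ 0)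
    (hb : P {ω | 1 / ((b : ℝ) + 1) ≤ -X ω ∧ -X ω ≤ b + 1} ≠ 0) {K : ℝ}
    (haK : (a : ℝ) + 1 ≤ K) (hbK : (b : ℝ) + 1 ≤ K) :
    Tendsto (mgf X (P.restrict {ω | |X ω| ≤ K})) (cocompact ℝ) atTop := by
  have hS : MeasurableSet {ω | |X ω| ≤ K} := measurableSet_le hX.abs measurable_const
  have hint := integrable_exp_mul_restrict_abs_le (P := P) hX K
  rw [cocompact_eq_atBot_atTop, tendsto_sup]
  constructor
  · have h1 : Tendsto (mgf (-X) (P.restrict {ω | |X ω| ≤ K})) atTop atTop := by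
      refine tendsto_mgf_atTop hX.neg (fun t => by simpa using hint (-t))
        (ε := 1 / ((b : ℝ) + 1)) (by positivity) ?_
      rw [Measure.restrict_apply' hS]
      refine fun h0 => hb (measure_mono_null ?_ h0)
      rintro ω ⟨h1, h2⟩
      have : 0 < 1 / ((b : ℝ) + 1) := by positivity
      exact ⟨h1, show |X ω| ≤ K from abs_le.2 ⟨by linarith, by linarith⟩⟩
    have h2 := h1.comp tendsto_neg_atBot_atTop
    refine h2.congr fun t => ?_
    simp [mgf_neg]
  · refine tendsto_mgf_atTop hX hint (ε := 1 / ((a : ℝ) + 1)) (by positivity) ?_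
    rw [Measure.restrict_apply' hS]
    refine fun h0 => ha (measure_mono_null ?_ h0)
    rintro ω ⟨h1, h2⟩
    have : 0 < 1 / ((a : ℝ) + 1) := by positivity
    exact ⟨h1, show |X ω| ≤ K from abs_le.2 ⟨by linarith, by linarith⟩⟩

theorem ofReal_mgf_restrict [IsFiniteMeasure P] {X : Ω → ℝ} (hX : Measurable X) (K t : ℝ) :
    ENNReal.ofReal (mgf X (P.restrict {ω | |X ω| ≤ K}) t)
      = ∫⁻ ω in {ω | |X ω| ≤ K}, ENNReal.ofReal (Real.exp (t * X ω)) ∂P :=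
  ofReal_integral_eq_lintegral_ofReal (integrable_exp_mul_restrict_abs_le hX K t)
    (ae_of_all _ fun _ => (Real.exp_pos _).le)

/-- Two-sided case: tilt the truncated law by `e^{θv}` at the minimiser `θ` of its moment generating
function. The vanishing derivative is the centring, and the minimum being at least `c` is the
domination. -/
theorem hasCenteredTilt_of_pos_of_neg [IsProbabilityMeasure P] {X : Ω → ℝ} (hX : Measurable X)
    {c c' : ℝ} (hc : 0 < c) (hcc' : c < c')
    (h : ∀ θ : ℝ, ENNReal.ofReal c' ≤ ∫⁻ ω, ENNReal.ofReal (Real.exp (θ * X ω)) ∂P)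
    (hpos : P {ω | 0 < X ω} ≠ 0) (hneg : P {ω | 0 < -X ω} ≠ 0) : HasCenteredTilt P X c := by
  obtain ⟨a, ha⟩ := exists_measure_Icc_ne_zero hpos
  obtain ⟨b, hb⟩ := exists_measure_Icc_ne_zero hneg
  set f : ℕ → ℝ → ℝ := fun k => mgf X (P.restrict {ω | |X ω| ≤ ((a + b + 1 + k : ℕ) : ℝ)}) with hf
  have hcont : ∀ k, Continuous (f k) := fun k =>
    continuous_mgf (integrable_exp_mul_restrict_abs_le hX _)
  have hlim : ∀ k, Tendsto (f k) (cocompact ℝ) atTop := fun k =>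
    tendsto_mgf_restrict_cocompact hX ha hb
      (by push_cast; have := (b.cast_nonneg : (0 : ℝ) ≤ b)
          have := (k.cast_nonneg : (0 : ℝ) ≤ k); linarith)
      (by push_cast; have := (a.cast_nonneg : (0 : ℝ) ≤ a)
          have := (k.cast_nonneg : (0 : ℝ) ≤ k); linarith)
  have hmono : Monotone fun k : ℕ => {ω | |X ω| ≤ ((a + b + 1 + k : ℕ) : ℝ)} := by
    intro k l hkl ω hω
    refine le_trans (show |X ω| ≤ _ from hω) ?_
    exact_mod_cast Nat.add_le_add_left hkl _
  -- Otherwise the sublevel sets `{f k ≤ c}` are nonempty, compact and nested decreasing. A common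
  -- point `θ` would give `E e^{θX} ≤ c < c'` by monotone convergence; this is where the gap between
  -- `c` and `c'` is spent.
  obtain ⟨k, hk⟩ : ∃ k, ∀ θ, c ≤ f k θ := by
    by_contra! hcon
    have hclosed : ∀ k, IsClosed {θ | f k θ ≤ c} := fun k => isClosed_le (hcont k) continuous_const
    have hcomp : IsCompact {θ | f 0 θ ≤ c} := by
      obtain ⟨t, ht, ht'⟩ := mem_cocompact.1 ((hlim 0).eventually (eventually_gt_atTop c))
      refine ht.of_isClosed_subset (hclosed 0) fun θ hθ => ?_
      by_contra hθt
      exact (show c < f 0 θ from ht' hθt).not_ge hθ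
    obtain ⟨θ, hθ⟩ := IsCompact.nonempty_iInter_of_sequence_nonempty_isCompact_isClosed
      (fun k => {θ | f k θ ≤ c}) (fun k θ hθ => by
        refine le_trans ?_ (show f (k + 1) θ ≤ c from hθ)
        refine integral_mono_measure (Measure.restrict_mono (hmono k.le_succ) le_rfl)
          (ae_of_all _ fun _ => (Real.exp_pos _).le) (integrable_exp_mul_restrict_abs_le hX _ _))
      (fun k => let ⟨θ, hθ⟩ := hcon k; ⟨θ, hθ.le⟩) hcomp hclosed
    rw [Set.mem_iInter] at hθ
    have hu : (⋃ k : ℕ, {ω | |X ω| ≤ ((a + b + 1 + k : ℕ) : ℝ)}) = Set.univ := by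
      refine Set.eq_univ_of_forall fun ω => Set.mem_iUnion.2 ?_
      obtain ⟨k, hk⟩ := exists_nat_ge |X ω|
      exact ⟨k, hk.trans (by exact_mod_cast Nat.le_add_left _ _)⟩
    have h1 := h θ
    rw [← setLIntegral_univ, ← hu, setLIntegral_iUnion_of_directed _ hmono.directed_le] at h1
    have h2 : ENNReal.ofReal c' ≤ ENNReal.ofReal c := h1.trans (iSup_le fun k => by
      rw [← ofReal_mgf_restrict hX]; exact ENNReal.ofReal_le_ofReal (hθ k))
    exact absurd ((ENNReal.ofReal_le_ofReal_iff hc.le).1 h2) (not_le.2 hcc')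
  obtain ⟨θ, hθ⟩ := (hcont k).exists_forall_le (hlim k)
  set K : ℝ := ((a + b + 1 + k : ℕ) : ℝ) with hK
  have hS : MeasurableSet {ω | |X ω| ≤ K} := measurableSet_le hX.abs measurable_const
  have hm := hk θ
  have hm0 : 0 < f k θ := hc.trans_le hm
  have hder : ∫ ω in {ω | |X ω| ≤ K}, X ω * Real.exp (θ * X ω) ∂P = 0 := by
    refine IsLocalMin.hasDerivAt_eq_zero (f := f k) (a := θ) (Eventually.of_forall hθ) ?_
    refine hasDerivAt_mgf ?_
    have : integrableExpSet X (P.restrict {ω | |X ω| ≤ K}) = Set.univ :=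
      Set.eq_univ_of_forall fun t => integrable_exp_mul_restrict_abs_le hX K t
    rw [this]; simp
  set g : ℝ → ℝ := Set.indicator {v | |v| ≤ K} fun v => Real.exp (θ * v) / f k θ with hg
  have hg' : ∀ (F : ℝ → ℝ), (fun ω => F (X ω) * g (X ω)) = {ω | |X ω| ≤ K}.indicator
      fun ω => F (X ω) * Real.exp (θ * X ω) / f k θ := by
    intro F
    ext ω
    by_cases hω : |X ω| ≤ K <;> simp [g, hω, mul_div_assoc]
  refine ⟨g, max K (Real.exp (|θ| * K) / f k θ), θ, ?_, ?_, ?_, ?_, ?_, ?_, ?_⟩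
  · exact Measurable.indicator (by fun_prop) (measurableSet_le measurable_norm measurable_const)
  · exact fun v => Set.indicator_nonneg (fun _ _ => by positivity) v
  · intro v
    by_cases hv : |v| ≤ K
    · refine le_max_of_le_right ?_
      simp only [g, Set.indicator_of_mem (show v ∈ {v | |v| ≤ K} from hv)]
      refine div_le_div_of_nonneg_right (Real.exp_le_exp.2 ?_) hm0.le
      calc θ * v ≤ |θ * v| := le_abs_self _
        _ = |θ| * |v| := abs_mul _ _
        _ ≤ |θ| * K := mul_le_mul_of_nonneg_left hv (abs_nonneg _)
    · simp only [g, Set.indicator_of_notMem (show v ∉ {v | |v| ≤ K} from hv)]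
      exact le_max_of_le_left (by positivity)
  · intro v hv
    have hv' : K < |v| := (le_max_left _ _).trans_lt hv
    exact Set.indicator_of_notMem (show v ∉ {v | |v| ≤ K} from not_le.2 hv') _
  · have := hg' fun _ => 1
    simp only [one_mul] at this
    rw [this, integral_indicator hS, integral_div]
    exact div_self hm0.ne'
  · have := hg' fun v => v
    rw [this, integral_indicator hS, integral_div, hder, zero_div]
  · intro v
    refine (Set.indicator_le_self' (fun _ _ => by positivity) v).trans ?_
    gcongr

/-- Almost optimal tilting: if `Λ*(x) < L`, then the law of `U` has a bounded and boundedly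
supported density with mean `x` that is dominated by an exponential `exp (b + θ u)` with
`b + θ x ≤ L`. -/
theorem exists_tilt [IsProbabilityMeasure P] {U : Ω → ℝ} (hU : Measurable U) {x L : ℝ}
    (h : fenchelLegendre P U x < L) :
    ∃ (g : ℝ → ℝ) (B b θ : ℝ), Measurable g ∧ (∀ v, 0 ≤ g v) ∧ (∀ v, g v ≤ B) ∧
      (∀ v, B < |v| → g v = 0) ∧ ∫ ω, g (U ω) ∂P = 1 ∧ ∫ ω, U ω * g (U ω) ∂P = x ∧
      (∀ v, g v ≤ Real.exp (b + θ * v)) ∧ b + θ * x ≤ L := by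
  -- The intermediate `L'` supplies the strict gap `e^{-L} < e^{-L'}` lost in the truncation.
  obtain ⟨L', hL1, hL2⟩ := EReal.exists_between_coe_real h
  rw [EReal.coe_lt_coe_iff] at hL2
  have hX : Measurable fun ω => U ω - x := hU.sub_const x
  have hc : (0 : ℝ) < Real.exp (-L) := Real.exp_pos _
  have hcc : Real.exp (-L) < Real.exp (-L') := Real.exp_lt_exp.2 (by linarith)
  have hlow : ∀ θ : ℝ, ENNReal.ofReal (Real.exp (-L'))
      ≤ ∫⁻ ω, ENNReal.ofReal (Real.exp (θ * (U ω - x))) ∂P := by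
    intro θ
    have h1 := ofReal_exp_le_lintegral_of_fenchelLegendre_le hL1.le θ
    have h2 : ∀ ω, ENNReal.ofReal (Real.exp (θ * (U ω - x)))
        = ENNReal.ofReal (Real.exp (-(θ * x))) * ENNReal.ofReal (Real.exp (θ * U ω)) := by
      intro ω
      rw [← ENNReal.ofReal_mul (Real.exp_pos _).le, ← Real.exp_add]
      ring_nf
    simp_rw [h2]
    rw [lintegral_const_mul _ (by fun_prop)]
    refine le_trans ?_ (mul_le_mul_right h1 _)
    rw [← ENNReal.ofReal_mul (Real.exp_pos _).le, ← Real.exp_add]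
    ring_nf; rfl
  have hlow' : ∀ θ : ℝ, ENNReal.ofReal (Real.exp (-L))
      ≤ ∫⁻ ω, ENNReal.ofReal (Real.exp (θ * (U ω - x))) ∂P := fun θ =>
    (ENNReal.ofReal_le_ofReal hcc.le).trans (hlow θ)
  have key : HasCenteredTilt P (fun ω => U ω - x) (Real.exp (-L)) := by
    by_cases hneg : P {ω | U ω - x < 0} = 0
    · exact hasCenteredTilt_of_nonneg hX hc hlow' hneg
    by_cases hpos : P {ω | 0 < U ω - x} = 0
    · refine HasCenteredTilt.of_neg (hasCenteredTilt_of_nonneg hX.neg hc (fun θ => ?_) ?_)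
      · simpa only [neg_mul, mul_neg, Pi.neg_apply] using hlow' (-θ)
      · simpa using hpos
    · exact hasCenteredTilt_of_pos_of_neg hX hc hcc hlow hpos (by simpa using hneg)
  obtain ⟨g, B, θ, h1, h2, h3, h4, h5, h6, h7⟩ := key
  have hB : 0 ≤ B := (h2 0).trans (h3 0)
  have hint : Integrable (fun ω => g (U ω - x)) P :=
    Integrable.of_bound (h1.comp hX).aestronglyMeasurable B
      (ae_of_all _ fun ω => by rw [Real.norm_eq_abs, abs_of_nonneg (h2 _)]; exact h3 _)
  have hint' : Integrable (fun ω => (U ω - x) * g (U ω - x)) P := by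
    refine Integrable.of_bound (hX.mul (h1.comp hX)).aestronglyMeasurable (B * B)
      (ae_of_all _ fun ω => ?_)
    rw [Real.norm_eq_abs, abs_mul, abs_of_nonneg (h2 _)]
    by_cases hω : B < |U ω - x|
    · rw [h4 _ hω]; simpa using mul_nonneg hB hB
    · exact mul_le_mul (not_lt.1 hω) (h3 _) (h2 _) hB
  refine ⟨fun v => g (v - x), B + |x|, L - θ * x, θ, h1.comp (measurable_id.sub_const x),
    fun v => h2 _, fun v => (h3 _).trans (by linarith [abs_nonneg x]), ?_, h5, ?_, ?_, by linarith⟩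
  · intro v hv
    refine h4 _ ?_
    have := abs_sub_abs_le_abs_sub v x
    linarith
  · have e : (fun ω => U ω * g (U ω - x))
        = fun ω => (U ω - x) * g (U ω - x) + x * g (U ω - x) := by ext; ring
    rw [e, integral_add hint' (hint.const_mul x), integral_const_mul, h5, h6]; ring
  · intro v
    refine (h7 _).trans (le_of_eq ?_)
    rw [← Real.exp_sub]; ring_nf

end Tilting

end LossLDP

namespace LossLDP

/-! ### The dual description of the rate function -/

/-! ### Splitting strict inequalities between extended-real sums -/

section EReal

theorem exists_coe_lt_of_coe_lt_add {a : ℝ} {s t : EReal} (hs : s ≠ ⊥) (ht : t ≠ ⊥)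
    (h : (a : EReal) < s + t) : ∃ u v : ℝ, (u : EReal) < s ∧ (v : EReal) < t ∧ a < u + v := by
  induction s using EReal.rec with
  | bot => exact absurd rfl hs
  | top =>
    obtain ⟨v, -, hv⟩ := EReal.exists_between_coe_real (bot_lt_iff_ne_bot.2 ht)
    exact ⟨a - v + 1, v, EReal.coe_lt_top _, hv, by linarith⟩
  | coe x =>
    induction t using EReal.rec with
    | bot => exact absurd rfl ht
    | top => exact ⟨x - 1, a - x + 2, by norm_cast; linarith, EReal.coe_lt_top _, by linarith⟩
    | coe y =>
      have h' : a < x + y := by exact_mod_cast h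
      exact ⟨x - (x + y - a) / 3, y - (x + y - a) / 3, by norm_cast; linarith,
        by norm_cast; linarith, by linarith⟩

theorem coe_sum {ι : Type*} (s : Finset ι) (f : ι → ℝ) :
    ((∑ i ∈ s, f i : ℝ) : EReal) = ∑ i ∈ s, (f i : EReal) := by
  classical
  induction s using Finset.induction_on with
  | empty => simp
  | insert i s hi ih => rw [Finset.sum_insert hi, Finset.sum_insert hi, EReal.coe_add, ih]

theorem sum_ne_bot {ι : Type*} (s : Finset ι) {t : ι → EReal} (ht : ∀ i, t i ≠ ⊥) :
    ∑ i ∈ s, t i ≠ ⊥ := by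
  classical
  induction s using Finset.induction_on with
  | empty => simp
  | insert i s hi ih =>
    rw [Finset.sum_insert hi, Ne, EReal.add_eq_bot_iff, not_or]
    exact ⟨ht i, ih⟩

theorem exists_coe_lt_of_coe_lt_sum {ι : Type*} (s : Finset ι) {t : ι → EReal}
    (ht : ∀ i, t i ≠ ⊥) {a : ℝ} (h : (a : EReal) < ∑ i ∈ s, t i) :
    ∃ r : ι → ℝ, (∀ i, (r i : EReal) < t i) ∧ a < ∑ i ∈ s, r i := by
  classical
  have hr : ∀ i, ∃ r : ℝ, (r : EReal) < t i := fun i =>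
    let ⟨r, _, hr⟩ := EReal.exists_between_coe_real (bot_lt_iff_ne_bot.2 (ht i))
    ⟨r, hr⟩
  induction s using Finset.induction_on generalizing a with
  | empty =>
    choose r hr using hr
    exact ⟨r, hr, by simpa using h⟩
  | insert i s hi ih =>
    rw [Finset.sum_insert hi] at h
    obtain ⟨u, v, hu, hv, huv⟩ := exists_coe_lt_of_coe_lt_add (ht i) (sum_ne_bot s ht) h
    obtain ⟨r, hr1, hr2⟩ := ih hv
    refine ⟨Function.update r i u, fun j => ?_, ?_⟩
    · by_cases hj : j = i
      · subst hj; simpa using hu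
      · simpa [hj] using hr1 j
    · rw [Finset.sum_insert hi, Function.update_self, Finset.sum_congr rfl (g := r)]
      · linarith
      · intro j hj
        exact Function.update_of_ne (by rintro rfl; exact hi hj) _ _

end EReal

/-! ### Dual formula for the summands and lower semicontinuity -/

section Duality

variable {Ω : Type*} [MeasurableSpace Ω] {P : Measure Ω} {X : Ω → ℝ} {N : ℕ}

/-- The moment generating function with values in `[0, ∞]`. -/
noncomputable def emgf (P : Measure Ω) (X : Ω → ℝ) (θ : ℝ) : ℝ≥0∞ :=
  ∫⁻ ω, ENNReal.ofReal (Real.exp (θ * X ω)) ∂P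

theorem logMGF_eq (θ : ℝ) : logMGF P X θ = ENNReal.log (emgf P X θ) := rfl

/-- The affine functional of `(φ, d)` attached to the dual variables `(η, θ)`. -/
noncomputable def dualValue (P : Measure Ω) (X : Ω → ℝ) (p : Fin N → ℝ≥0∞) (η θ φ d : Fin N → ℝ) :
    ℝ :=
  ∑ i, (η i * φ i + θ i * d i + φ i
    - (p i * ENNReal.ofReal (Real.exp (η i)) * emgf P X (θ i)).toReal)

theorem continuous_increment (i : Fin N) : Continuous fun x : PathSpace N => increment x.1 i := by
  unfold increment
  have h : ∀ j : Fin N, Continuous fun x : PathSpace N => x.1 j := fun j =>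
    (continuous_apply j).comp continuous_subtype_val
  split_ifs
  · exact (h i).sub continuous_const
  · exact (h i).sub (h _)

theorem continuous_dualValue_increment (p : Fin N → ℝ≥0∞) (η θ : Fin N → ℝ) :
    Continuous fun z : PathSpace N × (Fin N → ℝ) =>
      dualValue P X p η θ z.2 (fun i => increment z.1.1 i) := by
  have h : ∀ i, Continuous fun z : PathSpace N × (Fin N → ℝ) => increment z.1.1 i := fun i =>
    (continuous_increment i).comp continuous_fst
  unfold dualValue
  fun_prop

variable [IsProbabilityMeasure P]

theorem emgf_zero : emgf P X 0 = 1 := by simp [emgf]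

theorem emgf_ne_zero (hX : Measurable X) (θ : ℝ) : emgf P X θ ≠ 0 := by
  intro h
  rw [emgf, lintegral_eq_zero_iff (by fun_prop)] at h
  obtain ⟨ω, hω⟩ := h.exists
  simp [not_le.2 (Real.exp_pos _)] at hω

theorem logMGF_eq_coe (hX : Measurable X) {θ : ℝ} (h : emgf P X θ ≠ ⊤) :
    logMGF P X θ = (Real.log (emgf P X θ).toReal : ℝ) := by
  rw [logMGF_eq, ENNReal.log_pos_real (emgf_ne_zero hX θ) h]

theorem fenchelLegendre_nonneg (x : ℝ) : 0 ≤ fenchelLegendre P X x := by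
  refine le_trans ?_ (le_iSup _ 0)
  simp [logMGF_eq, emgf_zero]

theorem fenchelLegendre_ne_bot (x : ℝ) : fenchelLegendre P X x ≠ ⊥ :=
  ne_bot_of_le_ne_bot (by simp) (fenchelLegendre_nonneg x)

theorem log_ofReal_div_eq_coe {p : ℝ≥0∞} (hp : p ≠ ⊤) (hp0 : p ≠ 0) {φ : ℝ} (hφ : 0 < φ) :
    ENNReal.log (ENNReal.ofReal φ / p) = (Real.log (φ / p.toReal) : ℝ) := by
  have h : 0 < (ENNReal.ofReal φ / p).toReal := by
    rw [ENNReal.toReal_div, ENNReal.toReal_ofReal hφ.le]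
    exact div_pos hφ (ENNReal.toReal_pos hp0 hp)
  rw [ENNReal.log_pos_real' h, ENNReal.toReal_div, ENNReal.toReal_ofReal hφ.le]

theorem rateTerm_eq_top_of_zero {φ d : ℝ} (hφ : 0 < φ) :
    rateTerm (fenchelLegendre P X) 0 φ d = ⊤ := by
  have h : ENNReal.ofReal φ / 0 = ⊤ := ENNReal.div_zero (by simpa using hφ)
  rw [rateTerm, if_neg hφ.ne', h, ENNReal.log_top,
    EReal.top_add_of_ne_bot (fenchelLegendre_ne_bot _), EReal.coe_mul_top_of_pos hφ]

/-- The dual lower bound for a summand of the rate function. -/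
theorem le_rateTerm (hX : Measurable X) {p : ℝ≥0∞} (hp : p ≠ ⊤) {φ d η θ : ℝ} (hφ : 0 ≤ φ)
    (hq : p * ENNReal.ofReal (Real.exp η) * emgf P X θ ≠ ⊤) :
    ((η * φ + θ * d + φ - (p * ENNReal.ofReal (Real.exp η) * emgf P X θ).toReal : ℝ) : EReal)
      ≤ rateTerm (fenchelLegendre P X) p φ d := by
  rcases hφ.eq_or_lt with rfl | hφ
  · rw [rateTerm, if_pos rfl]
    split_ifs with hd
    · subst hd
      rw [← EReal.coe_zero, EReal.coe_le_coe_iff]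
      have : 0 ≤ (p * ENNReal.ofReal (Real.exp η) * emgf P X θ).toReal := ENNReal.toReal_nonneg
      linarith
    · exact le_top
  rcases eq_or_ne p 0 with rfl | hp0
  · rw [rateTerm_eq_top_of_zero hφ]; exact le_top
  have hM : emgf P X θ ≠ ⊤ := by
    intro h
    refine hq ?_
    rw [h, ENNReal.mul_top]
    simp [hp0, Real.exp_pos]
  rw [rateTerm, if_neg hφ.ne', log_ofReal_div_eq_coe hp hp0 hφ]
  have h1 : ((θ * (d / φ) - Real.log (emgf P X θ).toReal : ℝ) : EReal)
      ≤ fenchelLegendre P X (d / φ) := by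
    rw [EReal.coe_sub, ← logMGF_eq_coe hX hM]
    exact le_iSup (fun θ : ℝ => ((θ * (d / φ) : ℝ) : EReal) - logMGF P X θ) θ
  have hr : 0 < p.toReal := ENNReal.toReal_pos hp0 hp
  have hm : 0 < (emgf P X θ).toReal := ENNReal.toReal_pos (emgf_ne_zero hX θ) hM
  refine le_trans ?_ (mul_le_mul_of_nonneg_left (add_le_add_right h1 _)
    (by exact_mod_cast hφ.le))
  rw [← EReal.coe_add, ← EReal.coe_mul, EReal.coe_le_coe_iff, ENNReal.toReal_mul,
    ENNReal.toReal_mul, ENNReal.toReal_ofReal (Real.exp_pos _).le]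
  set r := p.toReal
  set m := (emgf P X θ).toReal
  -- The whole bound is `log y ≤ y - 1` at `y = p e^η M(θ) / φ`, multiplied by `φ`.
  have h2 := Real.log_le_sub_one_of_pos (show 0 < r * Real.exp η * m / φ by positivity)
  rw [Real.log_div (by positivity) hφ.ne', Real.log_mul (by positivity) hm.ne',
    Real.log_mul hr.ne' (Real.exp_pos _).ne', Real.log_exp] at h2
  have h3 := mul_le_mul_of_nonneg_left h2 hφ.le
  have h4 : φ * (r * Real.exp η * m / φ - 1) = r * Real.exp η * m - φ := by field_simp
  have h5 : φ * (θ * (d / φ)) = θ * d := by field_simp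
  rw [h4] at h3
  rw [Real.log_div hφ.ne' hr.ne']
  nlinarith

/-- The dual lower bounds for a summand of the rate function are sharp. -/
theorem exists_lt_of_lt_rateTerm (hX : Measurable X) {p : ℝ≥0∞} (hp : p ≠ ⊤) {φ d r : ℝ}
    (hφ : 0 ≤ φ) (hM : 0 < φ ∨ ∀ θ, emgf P X θ ≠ ⊤)
    (h : (r : EReal) < rateTerm (fenchelLegendre P X) p φ d) :
    ∃ η θ : ℝ, p * ENNReal.ofReal (Real.exp η) * emgf P X θ ≠ ⊤ ∧
      r < η * φ + θ * d + φ - (p * ENNReal.ofReal (Real.exp η) * emgf P X θ).toReal := by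
  rcases hφ.eq_or_lt with rfl | hφ
  · replace hM := hM.resolve_left (lt_irrefl _)
    -- When `φ = 0`, `η` enters only through `p e^η M(θ)`, which vanishes as `η → -∞` because `M(θ)`
    -- is finite. Then `θ d` is free to be arbitrarily large if `d ≠ 0`.
    have small : ∀ θ ε : ℝ, 0 < ε → ∃ η : ℝ,
        (p * ENNReal.ofReal (Real.exp η) * emgf P X θ).toReal < ε := by
      intro θ ε hε
      have hlim : Tendsto (fun η : ℝ => (p.toReal * Real.exp η) * (emgf P X θ).toReal) atBot
          (𝓝 ((p.toReal * 0) * (emgf P X θ).toReal)) :=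
        (Real.tendsto_exp_atBot.const_mul _).mul_const _
      rw [mul_zero, zero_mul] at hlim
      obtain ⟨η, hη⟩ := (hlim.eventually (gt_mem_nhds hε)).exists
      refine ⟨η, ?_⟩
      rwa [ENNReal.toReal_mul, ENNReal.toReal_mul, ENNReal.toReal_ofReal (Real.exp_pos _).le]
    have fin : ∀ η θ, p * ENNReal.ofReal (Real.exp η) * emgf P X θ ≠ ⊤ := fun η θ =>
      ENNReal.mul_ne_top (ENNReal.mul_ne_top hp ENNReal.ofReal_ne_top) (hM θ)
    rw [rateTerm, if_pos rfl] at h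
    split_ifs at h with hd
    · subst hd
      have hr : r < 0 := by exact_mod_cast h
      obtain ⟨η, hη⟩ := small 0 (-r) (by linarith)
      exact ⟨η, 0, fin _ _, by linarith⟩
    · obtain ⟨η, hη⟩ := small ((r + 2) / d) 1 one_pos
      refine ⟨η, (r + 2) / d, fin _ _, ?_⟩
      rw [div_mul_cancel₀ _ hd]; linarith
  rcases eq_or_ne p 0 with rfl | hp0
  · refine ⟨r / φ, 0, by simp, ?_⟩
    simp only [zero_mul, ENNReal.toReal_zero]
    rw [div_mul_cancel₀ _ hφ.ne']; linarith
  rw [rateTerm, if_neg hφ.ne', log_ofReal_div_eq_coe hp hp0 hφ] at h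
  have hr : 0 < p.toReal := ENNReal.toReal_pos hp0 hp
  set l := Real.log (φ / p.toReal) with hl
  have h1 : ((r / φ - l : ℝ) : EReal) < fenchelLegendre P X (d / φ) := by
    by_contra! hcon
    refine absurd h (not_lt.2 ?_)
    calc (φ : EReal) * (l + fenchelLegendre P X (d / φ))
        ≤ φ * (l + (r / φ - l : ℝ)) :=
          mul_le_mul_of_nonneg_left (add_le_add_right hcon _) (by exact_mod_cast hφ.le)
      _ = r := by
          rw [← EReal.coe_add, ← EReal.coe_mul, EReal.coe_eq_coe_iff]; field_simp; ring
  rw [fenchelLegendre, lt_iSup_iff] at h1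
  obtain ⟨θ, hθ⟩ := h1
  have hMθ : emgf P X θ ≠ ⊤ := by
    intro htop
    rw [logMGF_eq, htop, ENNReal.log_top, EReal.sub_top] at hθ
    exact not_lt_bot hθ
  rw [logMGF_eq_coe hX hMθ, ← EReal.coe_sub, EReal.coe_lt_coe_iff] at hθ
  have hm : 0 < (emgf P X θ).toReal := ENNReal.toReal_pos (emgf_ne_zero hX θ) hMθ
  -- This `η` makes `p e^η M(θ) = φ`, the equality case of `log y ≤ y - 1`.
  refine ⟨l - Real.log (emgf P X θ).toReal, θ,
    ENNReal.mul_ne_top (ENNReal.mul_ne_top hp ENNReal.ofReal_ne_top) hMθ, ?_⟩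
  rw [ENNReal.toReal_mul, ENNReal.toReal_mul, ENNReal.toReal_ofReal (Real.exp_pos _).le,
    Real.exp_sub, Real.exp_log hm, hl, Real.exp_log (by positivity), ← hl]
  have h2 : p.toReal * (φ / p.toReal / (emgf P X θ).toReal) * (emgf P X θ).toReal = φ := by
    field_simp
  rw [h2]
  have h3 := mul_lt_mul_of_pos_left hθ hφ
  have h4 : φ * (r / φ - l) = r - φ * l := by field_simp
  have h5 : φ * (θ * (d / φ) - Real.log (emgf P X θ).toReal)
      = θ * d - φ * Real.log (emgf P X θ).toReal := by field_simp
  rw [h4, h5] at h3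
  linarith

theorem rateTerm_ne_bot (hX : Measurable X) {p : ℝ≥0∞} (hp : p ≠ ⊤) {φ : ℝ} (hφ : 0 ≤ φ) (d : ℝ) :
    rateTerm (fenchelLegendre P X) p φ d ≠ ⊥ := by
  have h := le_rateTerm (P := P) hX hp (η := 0) (θ := 0) (d := d) hφ (by simp [emgf_zero, hp])
  exact ne_bot_of_le_ne_bot (EReal.coe_ne_bot _) h

theorem dualValue_le (hX : Measurable X) {p : Fin N → ℝ≥0∞} (hp : ∀ i, p i ≠ ⊤)
    {η θ φ d : Fin N → ℝ} (hφ : ∀ i, 0 ≤ φ i)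
    (hq : ∀ i, p i * ENNReal.ofReal (Real.exp (η i)) * emgf P X (θ i) ≠ ⊤) :
    (dualValue P X p η θ φ d : EReal)
      ≤ ∑ i, rateTerm (fenchelLegendre P X) (p i) (φ i) (d i) := by
  rw [dualValue, coe_sum]
  exact Finset.sum_le_sum fun i _ => le_rateTerm hX (hp i) (hφ i) (hq i)

theorem exists_lt_dualValue (hX : Measurable X) {p : Fin N → ℝ≥0∞} (hp : ∀ i, p i ≠ ⊤)
    {φ d : Fin N → ℝ} (hφ : ∀ i, 0 ≤ φ i) (hM : ∀ i, 0 < φ i ∨ ∀ θ, emgf P X θ ≠ ⊤) {a : ℝ}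
    (h : (a : EReal) < ∑ i, rateTerm (fenchelLegendre P X) (p i) (φ i) (d i)) :
    ∃ η θ : Fin N → ℝ, (∀ i, p i * ENNReal.ofReal (Real.exp (η i)) * emgf P X (θ i) ≠ ⊤) ∧
      a < dualValue P X p η θ φ d := by
  obtain ⟨r, hr, ha⟩ := exists_coe_lt_of_coe_lt_sum Finset.univ
    (fun i => rateTerm_ne_bot hX (hp i) (hφ i) (d i)) h
  choose η θ hq hlt using fun i => exists_lt_of_lt_rateTerm hX (hp i) (hφ i) (hM i) (hr i)
  exact ⟨η, θ, hq, ha.trans_le (Finset.sum_le_sum fun i _ => (hlt i).le)⟩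

/-- Nonnegativity is the dual bound at `η = θ = 0`, where `∑ φ_i - ∑ p_i = 0`. Lower semicontinuity
survives the infimum because `φ` ranges over a compact set and the dual bounds hold jointly near
each `(x, φ)`. -/
theorem isRateFunction_rateFunction (hX : Measurable X) {p : Fin N → ℝ≥0∞} (hp : ∑ i, p i = 1)
    (hM : ∀ φ ∈ stdSimplex ℝ (Fin N), ∀ i, 0 < φ i ∨ ∀ θ, emgf P X θ ≠ ⊤) :
    IsRateFunction (rateFunction P X p) := by
  have hp' : ∀ i, p i ≠ ⊤ := fun i => ne_top_of_le_ne_top ENNReal.one_ne_top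
    (hp ▸ Finset.single_le_sum (fun _ _ => zero_le) (Finset.mem_univ i))
  constructor
  · intro x
    refine le_iInf₂ fun φ hφ => ?_
    refine le_trans ?_ (dualValue_le hX hp' (η := 0) (θ := 0) hφ.1
      (fun i => by simp [emgf_zero, hp']))
    have : dualValue P X p 0 0 φ (fun i => increment x.1 i) = 0 := by
      simp only [dualValue, Pi.zero_apply, zero_mul, Real.exp_zero, ENNReal.ofReal_one, mul_one,
        emgf_zero, zero_add]
      rw [Finset.sum_sub_distrib, hφ.2, ← ENNReal.toReal_sum (fun i _ => hp' i), hp]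
      simp
    rw [this, EReal.coe_zero]
  · intro x a hax
    obtain ⟨b, hab, hbx⟩ := exists_between hax
    obtain ⟨c, hbc, hcx⟩ := EReal.exists_between_coe_real hbx
    -- Membership is repeated inside the predicate because the compactness argument uses full
    -- neighbourhoods of `φ` in `ℝ^N`, while the dual bound needs `φ ≥ 0`.
    have key : ∀ᶠ y in 𝓝 x, ∀ φ ∈ stdSimplex ℝ (Fin N), φ ∈ stdSimplex ℝ (Fin N) →
        (c : EReal) < ∑ i, rateTerm (fenchelLegendre P X) (p i) (φ i) (increment y.1 i) := by
      refine (isCompact_stdSimplex ℝ (Fin N)).eventually_forall_of_forall_eventually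
        (fun φ hφ => ?_)
      obtain ⟨η, θ, hq, hlt⟩ := exists_lt_dualValue hX hp' hφ.1 (hM φ hφ)
        (hcx.trans_le (iInf₂_le φ hφ))
      have hev := (continuous_dualValue_increment (P := P) (X := X) p η θ).tendsto (x, φ)
        |>.eventually (lt_mem_nhds hlt)
      filter_upwards [hev] with z hz hz2
      exact (EReal.coe_lt_coe_iff.2 hz).trans_le (dualValue_le hX hp' hz2.1 hq)
    filter_upwards [key] with y hy
    exact hab.trans (hbc.trans_le (le_iInf₂ fun φ hφ => (hy φ hφ hφ).le))

end Duality

end LossLDP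

namespace LossLDP

/-! ### The number and the loss of the defaults at a grid point -/

section Counting

variable {N : ℕ}

/-- The indicator of the event that the default time is the `i`-th grid point. -/
def gridInd (i : Fin N) (e : ℝ × ℕ) : ℝ := if e.2 = (i : ℕ) + 1 then 1 else 0

theorem measurable_gridInd (i : Fin N) : Measurable (gridInd i) :=
  Measurable.ite (measurable_snd (measurableSet_singleton _)) measurable_const measurable_const

theorem gridInd_nonneg (i : Fin N) (e : ℝ × ℕ) : 0 ≤ gridInd i e := by
  unfold gridInd; split_ifs <;> norm_num

theorem sum_ite_grid {M : Type*} [AddCommMonoid M] {t : ℕ} {i : Fin N} (h : t = (i : ℕ) + 1)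
    (g : Fin N → M) : ∑ j : Fin N, (if t = (j : ℕ) + 1 then g j else 0) = g i := by
  subst h
  rw [Finset.sum_eq_single i]
  · simp
  · intro j _ hj
    rw [if_neg]
    intro h
    exact hj (Fin.ext (by omega))
  · simp

theorem exists_fin_of_mem_grid {t : ℕ} (h : t ∈ Finset.Icc 1 N) : ∃ i : Fin N, t = (i : ℕ) + 1 := by
  rw [Finset.mem_Icc] at h
  exact ⟨⟨t - 1, by omega⟩, by simp; omega⟩

theorem sum_gridInd_mul {e : ℝ × ℕ} {i : Fin N} (h : e.2 = (i : ℕ) + 1) (g : Fin N → ℝ) :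
    ∑ j : Fin N, gridInd j e * g j = g i := by
  rw [← sum_ite_grid h g]
  refine Finset.sum_congr rfl fun j _ => ?_
  unfold gridInd; split_ifs <;> simp

variable {Ω : Type*} {U : ℕ → Ω → ℝ} {τ : ℕ → Ω → ℕ}

/-- The fraction of the first `n` obligors that default at the `i`-th grid point. -/
noncomputable def gridFreq (U : ℕ → Ω → ℝ) (τ : ℕ → Ω → ℕ) (n : ℕ) (ω : Ω) (i : Fin N) : ℝ :=
  (∑ k ∈ Finset.range n, gridInd i (U k ω, τ k ω)) / n

/-- The average loss of the first `n` obligors at the `i`-th grid point. -/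
noncomputable def gridLoss (U : ℕ → Ω → ℝ) (τ : ℕ → Ω → ℕ) (n : ℕ) (ω : Ω) (i : Fin N) : ℝ :=
  (∑ k ∈ Finset.range n, gridInd i (U k ω, τ k ω) * U k ω) / n

theorem gridFreq_mem_stdSimplex {ω : Ω} (hω : ∀ k, τ k ω ∈ Finset.Icc 1 N) {n : ℕ} (hn : 0 < n) :
    (gridFreq U τ n ω : Fin N → ℝ) ∈ stdSimplex ℝ (Fin N) := by
  refine ⟨fun i => div_nonneg (Finset.sum_nonneg fun k _ => gridInd_nonneg _ _) n.cast_nonneg, ?_⟩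
  unfold gridFreq
  rw [← Finset.sum_div, Finset.sum_comm, Finset.sum_congr rfl (g := fun _ => (1 : ℝ))]
  · simp [hn.ne']
  · intro k _
    obtain ⟨i, hi⟩ := exists_fin_of_mem_grid (hω k)
    simpa using sum_gridInd_mul (e := (U k ω, τ k ω)) hi fun _ => 1

/-- Coordinate `i` is time `i + 1`, so the previous value is the loss at time `i`; for `i = 0` it is
zero because default times are at least 1. -/
theorem increment_avgLossPath (hU : ∀ k ω, 0 ≤ U k ω) {ω : Ω}
    (hω : ∀ k, τ k ω ∈ Finset.Icc 1 N) (n : ℕ) (i : Fin N) :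
    increment (avgLossPath N U τ hU n ω).1 i = gridLoss U τ n ω i := by
  have h0 : (if (i : ℕ) = 0 then 0 else (avgLossPath N U τ hU n ω).1
      ⟨(i : ℕ) - 1, lt_of_le_of_lt (Nat.sub_le _ _) i.isLt⟩) = loss U τ n i ω / n := by
    split_ifs with hi
    · rw [hi, loss, Finset.sum_eq_zero, zero_div]
      intro k _
      have := (Finset.mem_Icc.1 (hω k)).1
      rw [if_neg (by omega), mul_zero]
    · simp only [avgLossPath]
      rw [Nat.sub_add_cancel (Nat.pos_of_ne_zero hi)]
  rw [increment, h0]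
  simp only [avgLossPath, gridLoss, loss]
  rw [← sub_div, ← Finset.sum_sub_distrib]
  congr 1
  refine Finset.sum_congr rfl fun k _ => ?_
  unfold gridInd
  dsimp only
  split_ifs <;> first | omega | simp

theorem sum_gridLoss_mul (θ : Fin N → ℝ) (n : ℕ) (ω : Ω) :
    ∑ i, θ i * gridLoss U τ n ω i
      = (∑ k ∈ Finset.range n, ∑ i : Fin N, gridInd i (U k ω, τ k ω) * (θ i * U k ω)) / n := by
  unfold gridLoss
  rw [Finset.sum_comm, Finset.sum_div]
  refine Finset.sum_congr rfl fun i _ => ?_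
  rw [← mul_div_assoc, Finset.mul_sum]
  congr 1
  exact Finset.sum_congr rfl fun k _ => by ring

theorem sum_gridFreq_mul (η : Fin N → ℝ) (n : ℕ) (ω : Ω) :
    ∑ i, η i * gridFreq U τ n ω i
      = (∑ k ∈ Finset.range n, ∑ i : Fin N, gridInd i (U k ω, τ k ω) * η i) / n := by
  unfold gridFreq
  rw [Finset.sum_comm, Finset.sum_div]
  refine Finset.sum_congr rfl fun i _ => ?_
  rw [← mul_div_assoc, Finset.mul_sum]
  congr 1
  exact Finset.sum_congr rfl fun k _ => by ring

theorem avgLossPath_le (hU : ∀ k ω, 0 ≤ U k ω) (n : ℕ) (ω : Ω) (i : Fin N) :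
    (avgLossPath N U τ hU n ω).1 i ≤ (∑ k ∈ Finset.range n, U k ω) / n := by
  simp only [avgLossPath, loss]
  refine div_le_div_of_nonneg_right (Finset.sum_le_sum fun k _ => ?_) n.cast_nonneg
  split_ifs
  · simp
  · simpa using hU k ω

theorem measurable_avgLossPath [MeasurableSpace Ω] (hUm : ∀ k, Measurable (U k))
    (hτm : ∀ k, Measurable (τ k)) (hU : ∀ k ω, 0 ≤ U k ω) (n : ℕ) :
    Measurable (avgLossPath N U τ hU n) := by
  refine Measurable.subtype_mk (measurable_pi_lambda _ fun i => ?_)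
  refine Measurable.div_const (Finset.measurable_sum _ fun k _ => (hUm k).mul ?_) _
  exact Measurable.ite (hτm k measurableSet_Iic) measurable_const measurable_const

end Counting

/-! ### The upper bound -/

section UpperBound

/-- The exponential Chebyshev inequality for sums of independent, identically distributed random
variables, with `Q - 1` in place of `log Q`. -/
theorem measure_sum_gt_le {Ω E : Type*} [MeasurableSpace Ω] [MeasurableSpace E] {P : Measure Ω}
    {V : ℕ → Ω → E} (hV : ∀ k, Measurable (V k)) (hVi : iIndepFun V P)
    (hVd : ∀ k, IdentDistrib (V k) (V 0) P P) {f : E → ℝ} (hf : Measurable f) {Q : ℝ≥0∞}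
    (hQ : ∫⁻ ω, ENNReal.ofReal (Real.exp (f (V 0 ω))) ∂P = Q) (hQt : Q ≠ ⊤) (n : ℕ) (a : ℝ) :
    P {ω | n * a < ∑ k ∈ Finset.range n, f (V k ω) + n * (1 - Q.toReal)}
      ≤ ENNReal.ofReal (Real.exp (-(n * a))) := by
  have hg : Measurable fun e => ENNReal.ofReal (Real.exp (f e)) := by fun_prop
  have h1 : ∫⁻ ω, ∏ k ∈ Finset.range n, ENNReal.ofReal (Real.exp (f (V k ω))) ∂P = Q ^ n := by
    rw [lintegral_prod_eq_prod_lintegral_of_indepFun (Finset.range n)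
      (fun k ω => ENNReal.ofReal (Real.exp (f (V k ω)))) (hVi.comp _ fun _ => hg)
      fun k => hg.comp (hV k)]
    rw [Finset.prod_congr rfl (g := fun _ => Q)]
    · simp
    · intro k _
      rw [← hQ]
      exact ((hVd k).comp hg).lintegral_eq
  have h2 : ∀ ω, ∏ k ∈ Finset.range n, ENNReal.ofReal (Real.exp (f (V k ω)))
      = ENNReal.ofReal (Real.exp (∑ k ∈ Finset.range n, f (V k ω))) := by
    intro ω
    rw [← ENNReal.ofReal_prod_of_nonneg fun k _ => (Real.exp_pos _).le, Real.exp_sum]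
  simp_rw [h2] at h1
  set c : ℝ := n * (a - 1 + Q.toReal) with hc
  have h3 := mul_meas_ge_le_lintegral (μ := P)
    (f := fun ω => ENNReal.ofReal (Real.exp (∑ k ∈ Finset.range n, f (V k ω))))
    (by have := fun k => hf.comp (hV k); fun_prop) (ENNReal.ofReal (Real.exp c))
  rw [h1] at h3
  -- From `Q ≤ e^{Q-1}`; this matches the dual functional, which carries `Q` itself and not its
  -- logarithm.
  have h4 : Q ^ n ≤ ENNReal.ofReal (Real.exp (n * (Q.toReal - 1))) := by
    conv_lhs => rw [← ENNReal.ofReal_toReal hQt]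
    rw [← ENNReal.ofReal_pow ENNReal.toReal_nonneg, Real.exp_nat_mul]
    refine ENNReal.ofReal_le_ofReal (pow_le_pow_left₀ ENNReal.toReal_nonneg ?_ n)
    linarith [Real.add_one_le_exp (Q.toReal - 1)]
  have h5 : P {ω | n * a < ∑ k ∈ Finset.range n, f (V k ω) + n * (1 - Q.toReal)}
      ≤ P {ω | ENNReal.ofReal (Real.exp c)
        ≤ ENNReal.ofReal (Real.exp (∑ k ∈ Finset.range n, f (V k ω)))} := by
    refine measure_mono fun ω hω => ?_
    refine ENNReal.ofReal_le_ofReal (Real.exp_le_exp.2 ?_)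
    simp only [Set.mem_ofPred_eq] at hω
    rw [hc]; nlinarith
  have h6 : ENNReal.ofReal (Real.exp (-c)) * ENNReal.ofReal (Real.exp c) = 1 := by
    rw [← ENNReal.ofReal_mul (Real.exp_pos _).le, ← Real.exp_add]; simp
  calc _ ≤ _ := h5
    _ = ENNReal.ofReal (Real.exp (-c)) * (ENNReal.ofReal (Real.exp c) * P {ω |
          ENNReal.ofReal (Real.exp c)
            ≤ ENNReal.ofReal (Real.exp (∑ k ∈ Finset.range n, f (V k ω)))}) := by
        rw [← mul_assoc, h6, one_mul]
    _ ≤ ENNReal.ofReal (Real.exp (-c)) * ENNReal.ofReal (Real.exp (n * (Q.toReal - 1))) := by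
        gcongr; exact h3.trans h4
    _ = ENNReal.ofReal (Real.exp (-(n * a))) := by
        rw [← ENNReal.ofReal_mul (Real.exp_pos _).le, ← Real.exp_add, hc]
        ring_nf

variable {Ω : Type*} [MeasurableSpace Ω] {P : Measure Ω} {N : ℕ} {U : ℕ → Ω → ℝ} {τ : ℕ → Ω → ℕ}

theorem measurable_ite_grid {T : Ω → ℕ} (hT : Measurable T) {h : Ω → ℝ≥0∞} (hh : Measurable h)
    (j : ℕ) : Measurable fun ω => if T ω = j then h ω else 0 :=
  Measurable.ite (hT (measurableSet_singleton j)) hh measurable_const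

/-- The independence of the loss and the default time of an obligor. -/
theorem lintegral_grid_eq {X : Ω → ℝ} {T : Ω → ℕ} (hX : Measurable X) (hT : Measurable T)
    (hXT : IndepFun X T P) {h : ℝ → ℝ≥0∞} (hh : Measurable h) (i : Fin N) :
    ∫⁻ ω, (if T ω = (i : ℕ) + 1 then h (X ω) else 0) ∂P
      = defaultDist P N T i * ∫⁻ ω, h (X ω) ∂P := by
  set s : ℕ → ℝ≥0∞ := fun t => if t = (i : ℕ) + 1 then 1 else 0 with hs
  have hsm : Measurable s := measurable_from_nat
  have h1 := lintegral_mul_eq_lintegral_mul_lintegral_of_indepFun (hsm.comp hT) (hh.comp hX)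
    (hXT.symm.comp hsm hh)
  have h2 : ∫⁻ ω, (s ∘ T) ω ∂P = defaultDist P N T i := by
    have hm : MeasurableSet {ω | T ω = (i : ℕ) + 1} := hT (measurableSet_singleton _)
    rw [defaultDist, ← lintegral_indicator_one hm]
    refine lintegral_congr fun ω => ?_
    simp [s, Set.indicator]
  rw [h2] at h1
  rw [← show ∫⁻ ω, (h ∘ X) ω ∂P = ∫⁻ ω, h (X ω) ∂P from rfl, ← h1]
  refine lintegral_congr fun ω => ?_
  simp [s]

theorem sum_defaultDist_eq_one [IsProbabilityMeasure P] {T : Ω → ℕ} (hT : Measurable T)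
    (hgrid : ∀ᵐ ω ∂P, T ω ∈ Finset.Icc 1 N) : ∑ i, defaultDist P N T i = 1 := by
  have h := fun i : Fin N => lintegral_grid_eq (P := P) (X := fun _ => (0 : ℝ)) (T := T)
    measurable_const hT (indepFun_const_left _ _) (h := fun _ => 1) measurable_const i
  simp only [lintegral_const, measure_univ, mul_one] at h
  simp_rw [← h]
  rw [← lintegral_finsetSum _ fun i _ => measurable_ite_grid hT measurable_const _]
  rw [lintegral_congr_ae (g := fun _ => 1)]
  · simp
  · filter_upwards [hgrid] with ω hω
    obtain ⟨i, hi⟩ := exists_fin_of_mem_grid hω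
    exact sum_ite_grid hi fun _ => 1

/-- Almost surely exactly one grid indicator is 1, so the exponential of the sum is a sum of
restricted exponentials, and independence factors each. -/
theorem lintegral_exp_grid {X : Ω → ℝ} {T : Ω → ℕ} (hX : Measurable X) (hT : Measurable T)
    (hXT : IndepFun X T P) (hgrid : ∀ᵐ ω ∂P, T ω ∈ Finset.Icc 1 N) (η θ : Fin N → ℝ) :
    ∫⁻ ω, ENNReal.ofReal (Real.exp
        (∑ i : Fin N, gridInd i (X ω, T ω) * (η i + θ i * X ω))) ∂P
      = ∑ i, defaultDist P N T i * ENNReal.ofReal (Real.exp (η i)) * emgf P X (θ i) := by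
  have h1 : ∀ i : Fin N, defaultDist P N T i * ENNReal.ofReal (Real.exp (η i)) * emgf P X (θ i)
      = ∫⁻ ω, (if T ω = (i : ℕ) + 1 then
          ENNReal.ofReal (Real.exp (η i + θ i * X ω)) else 0) ∂P := by
    intro i
    rw [lintegral_grid_eq hX hT hXT (h := fun u => ENNReal.ofReal (Real.exp (η i + θ i * u)))
      (by fun_prop), mul_assoc, emgf, ← lintegral_const_mul _ (by fun_prop)]
    simp_rw [Real.exp_add, ENNReal.ofReal_mul (Real.exp_pos _).le]
  simp_rw [h1]
  rw [← lintegral_finsetSum _ fun i _ => measurable_ite_grid hT (by fun_prop) _]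
  refine lintegral_congr_ae ?_
  filter_upwards [hgrid] with ω hω
  obtain ⟨i, hi⟩ := exists_fin_of_mem_grid hω
  rw [sum_ite_grid hi fun j => ENNReal.ofReal (Real.exp (η j + θ j * X ω)),
    sum_gridInd_mul (e := (X ω, T ω)) hi fun j => η j + θ j * X ω]

/-- At the empirical pair the dual functional becomes an i.i.d. sum, the form needed for Chebyshev;
the frequencies summing to 1 produce the constant `1 - Q`. -/
theorem dualValue_grid {p : Fin N → ℝ≥0∞} {X : Ω → ℝ} {η θ : Fin N → ℝ}
    (hq : ∀ i, p i * ENNReal.ofReal (Real.exp (η i)) * emgf P X (θ i) ≠ ⊤) {ω : Ω}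
    (hω : ∀ k, τ k ω ∈ Finset.Icc 1 N) {n : ℕ} (hn : 0 < n) :
    n * dualValue P X p η θ (gridFreq U τ n ω) (gridLoss U τ n ω)
      = ∑ k ∈ Finset.range n, ∑ i : Fin N, gridInd i (U k ω, τ k ω) * (η i + θ i * U k ω)
        + n * (1 - (∑ i, p i * ENNReal.ofReal (Real.exp (η i)) * emgf P X (θ i)).toReal) := by
  have hn' : (n : ℝ) ≠ 0 := by exact_mod_cast hn.ne'
  unfold dualValue
  rw [Finset.sum_sub_distrib, Finset.sum_add_distrib, Finset.sum_add_distrib,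
    (gridFreq_mem_stdSimplex hω hn).2, sum_gridLoss_mul, sum_gridFreq_mul,
    ENNReal.toReal_sum fun i _ => hq i]
  simp only [mul_add, Finset.sum_add_distrib]
  field_simp
  ring

/-- The exponential bound for compact sets of paths. -/
theorem measure_avgLossPath_mem_le_of_isCompact [IsProbabilityMeasure P]
    (hUm : ∀ k, Measurable (U k)) (hτm : ∀ k, Measurable (τ k)) (hU : ∀ k ω, 0 ≤ U k ω)
    (hgrid : ∀ᵐ ω ∂P, ∀ k, τ k ω ∈ Finset.Icc 1 N)
    (hVi : iIndepFun (fun k ω => (U k ω, τ k ω)) P)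
    (hVd : ∀ k, IdentDistrib (fun ω => (U k ω, τ k ω)) (fun ω => (U 0 ω, τ 0 ω)) P P)
    (hUτ : IndepFun (U 0) (τ 0) P)
    (hM : ∀ φ ∈ stdSimplex ℝ (Fin N), ∀ i, 0 < φ i ∨ ∀ θ, emgf P (U 0) θ ≠ ⊤)
    {F : Set (PathSpace N)} (hF : IsCompact F) {a : ℝ}
    (ha : ∀ x ∈ F, (a : EReal) < rateFunction P (U 0) (defaultDist P N (τ 0)) x) :
    ∃ C : ℝ≥0∞, C ≠ ⊤ ∧ ∀ n : ℕ, 0 < n → P {ω | avgLossPath N U τ hU n ω ∈ F}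
      ≤ C * ENNReal.ofReal (Real.exp (-(n * a))) := by
  have hgrid0 : ∀ᵐ ω ∂P, τ 0 ω ∈ Finset.Icc 1 N := hgrid.mono fun ω h => h 0
  have hp := sum_defaultDist_eq_one (hτm 0) hgrid0
  have hp' : ∀ i, defaultDist P N (τ 0) i ≠ ⊤ := fun i => measure_ne_top _ _
  -- Adjoining the frequency, which lies in the compact simplex almost surely, lets a single dual
  -- functional work near each `(x, φ)`; `C` counts the sets of a finite cover.
  have key : ∃ C : ℝ≥0∞, C ≠ ⊤ ∧ ∀ n : ℕ, 0 < n →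
      P {ω | (avgLossPath N U τ hU n ω, (gridFreq U τ n ω : Fin N → ℝ))
        ∈ F ×ˢ stdSimplex ℝ (Fin N)} ≤ C * ENNReal.ofReal (Real.exp (-(n * a))) := by
    refine (hF.prod (isCompact_stdSimplex ℝ (Fin N))).induction_on
      (p := fun S => ∃ C : ℝ≥0∞, C ≠ ⊤ ∧ ∀ n : ℕ, 0 < n →
        P {ω | (avgLossPath N U τ hU n ω, (gridFreq U τ n ω : Fin N → ℝ)) ∈ S}
          ≤ C * ENNReal.ofReal (Real.exp (-(n * a)))) ?_ ?_ ?_ ?_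
    · exact ⟨0, by simp, fun n _ => by simp⟩
    · rintro S S' hS ⟨C, hC, h⟩
      refine ⟨C, hC, fun n hn => le_trans (measure_mono fun ω hω => ?_) (h n hn)⟩
      exact hS hω
    · rintro S S' ⟨C, hC, h⟩ ⟨C', hC', h'⟩
      refine ⟨C + C', ENNReal.add_ne_top.2 ⟨hC, hC'⟩, fun n hn => ?_⟩
      rw [add_mul]
      exact (measure_union_le _ _).trans (add_le_add (h n hn) (h' n hn))
    · rintro ⟨x, φ⟩ ⟨hx, hφ⟩
      obtain ⟨η, θ, hq, hlt⟩ := exists_lt_dualValue (hUm 0) hp' hφ.1 (hM φ hφ)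
        ((ha x hx).trans_le (iInf₂_le φ hφ))
      refine ⟨{z | a < dualValue P (U 0) (defaultDist P N (τ 0)) η θ z.2
        (fun i => increment z.1.1 i)}, mem_nhdsWithin_of_mem_nhds
          ((continuous_dualValue_increment _ η θ).tendsto (x, φ)
            |>.eventually (lt_mem_nhds hlt)), 1, by simp, fun n hn => ?_⟩
      rw [one_mul]
      refine le_trans (measure_mono_ae ?_) (measure_sum_gt_le (V := fun k ω => (U k ω, τ k ω))
        (fun k => (hUm k).prodMk (hτm k)) hVi hVd
        (f := fun e => ∑ i : Fin N, gridInd i e * (η i + θ i * e.1))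
        (Finset.measurable_sum _ fun i _ => (measurable_gridInd i).mul (by fun_prop))
        (lintegral_exp_grid (hUm 0) (hτm 0) hUτ hgrid0 η θ)
        (ENNReal.sum_ne_top.2 fun i _ => hq i) n a)
      filter_upwards [hgrid] with ω hω h
      change a < dualValue P (U 0) (defaultDist P N (τ 0)) η θ (gridFreq U τ n ω)
        (fun i => increment (avgLossPath N U τ hU n ω).1 i) at h
      simp_rw [increment_avgLossPath hU hω] at h
      change n * a < _
      rw [← dualValue_grid hq hω hn]
      exact mul_lt_mul_of_pos_left h (by exact_mod_cast hn)
  obtain ⟨C, hC, h⟩ := key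
  refine ⟨C, hC, fun n hn => le_trans (measure_mono_ae ?_) (h n hn)⟩
  filter_upwards [hgrid] with ω hω h
  exact ⟨h, gridFreq_mem_stdSimplex hω hn⟩

theorem isCompact_setOf_forall_le (R : ℝ) : IsCompact {x : PathSpace N | ∀ i, x.1 i ≤ R} := by
  have hclosed : IsClosed {x : Fin N → ℝ | (∀ i, 0 ≤ x i) ∧ Monotone x} := by
    refine IsClosed.and ?_ ?_
    · simp only [Set.ofPred_forall]
      exact isClosed_iInter fun i => isClosed_le continuous_const (continuous_apply i)
    · exact isClosed_monotone
  rw [Subtype.isCompact_iff]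
  refine IsCompact.of_isClosed_subset
    (isCompact_univ_pi fun _ : Fin N => isCompact_Icc (a := (0 : ℝ)) (b := R)) ?_ ?_
  · have : Subtype.val '' {x : PathSpace N | ∀ i, x.1 i ≤ R}
        = {x : Fin N → ℝ | (∀ i, 0 ≤ x i) ∧ Monotone x} ∩ {x | ∀ i, x i ≤ R} := by
      ext x
      constructor
      · rintro ⟨y, hy, rfl⟩; exact ⟨y.2, hy⟩
      · rintro ⟨h1, h2⟩; exact ⟨⟨x, h1⟩, h2, rfl⟩
    rw [this]
    refine hclosed.inter ?_
    simp only [Set.ofPred_forall]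
    exact isClosed_iInter fun i => isClosed_le (continuous_apply i) continuous_const
  · rintro _ ⟨y, hy, rfl⟩ i -
    exact ⟨y.2.1 i, hy i⟩

/-- Exponential tightness. -/
theorem exists_measure_avgLossPath_gt_le
    (hUm : ∀ k, Measurable (U k)) (hU : ∀ k ω, 0 ≤ U k ω) (hUi : iIndepFun U P)
    (hUd : ∀ k, IdentDistrib (U k) (U 0) P P) {θ : ℝ} (hθ : 0 < θ) (hM : emgf P (U 0) θ ≠ ⊤)
    (a : ℝ) : ∃ R : ℝ, ∀ n : ℕ, 0 < n →
      P {ω | ¬ ∀ i, (avgLossPath N U τ hU n ω).1 i ≤ R} ≤ ENNReal.ofReal (Real.exp (-(n * a))) := by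
  set Q := emgf P (U 0) θ
  -- Every coordinate is at most the total average loss, so one scalar Chebyshev bound suffices.
  refine ⟨(a + Q.toReal) / θ, fun n hn => le_trans (measure_mono fun ω hω => ?_)
    (measure_sum_gt_le hUm hUi hUd (f := fun u => θ * u) (by fun_prop) (Q := Q) rfl hM n a)⟩
  simp only [Set.mem_ofPred_eq, not_forall, not_le] at hω
  obtain ⟨i, hi⟩ := hω
  have hn' : (0 : ℝ) < n := by exact_mod_cast hn
  have h1 := hi.trans_le (avgLossPath_le hU n ω i)
  rw [lt_div_iff₀ hn', div_mul_eq_mul_div, div_lt_iff₀ hθ] at h1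
  simp only [Set.mem_ofPred_eq, ← Finset.mul_sum]
  nlinarith

end UpperBound

end LossLDP

namespace LossLDP

/-! ### The lower bound -/

section LowerBound

/-- Excluding `⊥` matters: `⊥ + ⊤ = ⊥` lies below every real although `⊤` has no real upper bound.
-/
theorem exists_lt_coe_of_add_lt_coe {a : ℝ} {s t : EReal} (hs : s ≠ ⊥) (ht : t ≠ ⊥)
    (h : s + t < (a : EReal)) : ∃ u v : ℝ, s < (u : EReal) ∧ t < (v : EReal) ∧ u + v < a := by
  induction s using EReal.rec with
  | bot => exact absurd rfl hs
  | top => rw [EReal.top_add_of_ne_bot ht] at h; exact absurd h not_top_lt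
  | coe x =>
    induction t using EReal.rec with
    | bot => exact absurd rfl ht
    | top => rw [EReal.coe_add_top] at h; exact absurd h not_top_lt
    | coe y =>
      have h' : x + y < a := by exact_mod_cast h
      exact ⟨x + (a - (x + y)) / 3, y + (a - (x + y)) / 3, by norm_cast; linarith,
        by norm_cast; linarith, by linarith⟩

theorem exists_lt_coe_of_sum_lt_coe {ι : Type*} (s : Finset ι) {t : ι → EReal}
    (ht : ∀ i, t i ≠ ⊥) {a : ℝ} (h : ∑ i ∈ s, t i < (a : EReal)) :
    ∃ r : ι → ℝ, (∀ i ∈ s, t i < (r i : EReal)) ∧ ∑ i ∈ s, r i < a := by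
  classical
  induction s using Finset.induction_on generalizing a with
  | empty => exact ⟨0, by simp, by simpa using h⟩
  | insert i s hi ih =>
    rw [Finset.sum_insert hi] at h
    obtain ⟨u, v, hu, hv, huv⟩ := exists_lt_coe_of_add_lt_coe (ht i) (sum_ne_bot s ht) h
    obtain ⟨r, hr1, hr2⟩ := ih hv
    have hne : ∀ j ∈ s, j ≠ i := by rintro j hj rfl; exact hi hj
    refine ⟨Function.update r i u, fun j hj => ?_, ?_⟩
    · rcases Finset.mem_insert.1 hj with rfl | hj
      · simpa using hu
      · simpa [hne j hj] using hr1 j hj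
    · rw [Finset.sum_insert hi, Function.update_self, Finset.sum_congr rfl (g := r)]
      · linarith
      · exact fun j hj => Function.update_of_ne (hne j hj) _ _

variable {Ω : Type*} [MeasurableSpace Ω] {P : Measure Ω}

/-- Almost optimal weights for a summand of the rate function. -/
theorem exists_weight [IsProbabilityMeasure P] {X : Ω → ℝ} (hX : Measurable X) {p : ℝ≥0∞}
    (hp : p ≠ ⊤) {φ d r : ℝ} (hφ : 0 ≤ φ) (h : rateTerm (fenchelLegendre P X) p φ d < r) :
    ∃ (g : ℝ → ℝ) (B b θ : ℝ), Measurable g ∧ (∀ v, 0 ≤ g v) ∧ (∀ v, g v ≤ B) ∧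
      (∀ v, B < |v| → g v = 0) ∧ p.toReal * ∫ ω, g (X ω) ∂P = φ ∧
      p.toReal * ∫ ω, X ω * g (X ω) ∂P = d ∧
      (∀ v, g v ≤ Real.exp (b + θ * v)) ∧ b * φ + θ * d ≤ r := by
  rcases hφ.eq_or_lt with rfl | hφ
  · rw [rateTerm, if_pos rfl] at h
    split_ifs at h with hd
    · subst hd
      have hr : 0 < r := by exact_mod_cast h
      exact ⟨0, 0, 0, 0, measurable_zero, by simp, by simp, by simp, by simp, by simp,
        fun v => by simp, by simpa using hr.le⟩
    · exact absurd h not_top_lt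
  rcases eq_or_ne p 0 with rfl | hp0
  · rw [rateTerm_eq_top_of_zero hφ] at h; exact absurd h not_top_lt
  rw [rateTerm, if_neg hφ.ne', log_ofReal_div_eq_coe hp hp0 hφ] at h
  have hr : 0 < p.toReal := ENNReal.toReal_pos hp0 hp
  set l := Real.log (φ / p.toReal) with hl
  have h1 : fenchelLegendre P X (d / φ) < ((r / φ - l : ℝ) : EReal) := by
    by_contra! hcon
    refine absurd h (not_lt.2 ?_)
    calc (r : EReal) = φ * (l + (r / φ - l : ℝ)) := by
          rw [← EReal.coe_add, ← EReal.coe_mul, EReal.coe_eq_coe_iff]; field_simp; ring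
      _ ≤ (φ : EReal) * (l + fenchelLegendre P X (d / φ)) :=
          mul_le_mul_of_nonneg_left (add_le_add_right hcon _) (by exact_mod_cast hφ.le)
  obtain ⟨g, B, b, θ, g1, g2, g3, g4, g5, g6, g7, g8⟩ := exists_tilt hX h1
  have hexp : Real.exp l = φ / p.toReal := Real.exp_log (by positivity)
  -- The factor `e^l = φ / p` turns the default probability `p` into the prescribed frequency `φ`.
  refine ⟨fun v => Real.exp l * g v, max B (Real.exp l * B), b + l, θ, g1.const_mul _,
    fun v => mul_nonneg (Real.exp_pos _).le (g2 v), fun v => le_max_of_le_right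
      (mul_le_mul_of_nonneg_left (g3 v) (Real.exp_pos _).le), fun v hv => ?_, ?_, ?_, fun v => ?_, ?_⟩
  · simp only [g4 v ((le_max_left _ _).trans_lt hv), mul_zero]
  · rw [integral_const_mul, g5, hexp]; field_simp
  · simp_rw [mul_left_comm _ (Real.exp l)]
    rw [integral_const_mul, g6, hexp]; field_simp
  · calc Real.exp l * g v ≤ Real.exp l * Real.exp (b + θ * v) :=
          mul_le_mul_of_nonneg_left (g7 v) (Real.exp_pos _).le
      _ = Real.exp (b + l + θ * v) := by rw [← Real.exp_add]; ring_nf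
  · have h2 := mul_le_mul_of_nonneg_left g8 hφ.le
    have h3 : φ * (b + θ * (d / φ)) = b * φ + θ * d := by field_simp
    have h4 : φ * (r / φ - l) = r - l * φ := by field_simp
    rw [h3, h4] at h2
    linarith

variable {N : ℕ} {U : ℕ → Ω → ℝ} {τ : ℕ → Ω → ℕ}

theorem integral_gridInd_mul {X : Ω → ℝ} {T : Ω → ℕ} (hX : Measurable X) (hT : Measurable T)
    (hXT : IndepFun X T P) {h : ℝ → ℝ} (hh : Measurable h) (i : Fin N) :
    ∫ ω, gridInd i (X ω, T ω) * h (X ω) ∂P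
      = (defaultDist P N T i).toReal * ∫ ω, h (X ω) ∂P := by
  set s : ℕ → ℝ := fun t => if t = (i : ℕ) + 1 then 1 else 0 with hs
  have h1 := hXT.symm.integral_fun_comp_mul_comp (f := s) (g := h) hT.aemeasurable
    hX.aemeasurable measurable_from_nat.aestronglyMeasurable hh.aestronglyMeasurable
  have hm : MeasurableSet {ω | T ω = (i : ℕ) + 1} := hT (measurableSet_singleton _)
  have h2 : ∫ ω, s (T ω) ∂P = (defaultDist P N T i).toReal := by
    have : (fun ω => s (T ω)) = {ω | T ω = (i : ℕ) + 1}.indicator 1 := by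
      ext ω; simp [s, Set.indicator]
    rw [this, integral_indicator_one hm]; rfl
  rw [h2] at h1
  exact h1

theorem integrable_weight_mul_pow {E : Type*} [MeasurableSpace E] [IsFiniteMeasure P] {V : Ω → E}
    (hV : Measurable V) {W Y : E → ℝ} (hW : Measurable W) (hY : Measurable Y) {A : ℝ}
    (hW0 : ∀ e, 0 ≤ W e) (hWA : ∀ e, W e ≤ A) (hYA : ∀ e, W e ≠ 0 → |Y e| ≤ A) (j : ℕ) :
    Integrable (fun ω => W (V ω) * Y (V ω) ^ j) P := by
  refine Integrable.of_bound ((hW.comp hV).mul ((hY.comp hV).pow_const j)).aestronglyMeasurable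
    (A * A ^ j) (ae_of_all _ fun ω => ?_)
  have hA : 0 ≤ A := (hW0 (V ω)).trans (hWA _)
  rw [Real.norm_eq_abs, abs_mul, abs_of_nonneg (hW0 _), abs_pow]
  by_cases h : W (V ω) = 0
  · rw [h, zero_mul]; positivity
  · exact mul_le_mul (hWA _) (pow_le_pow_left₀ (abs_nonneg _) (hYA _ h) j) (by positivity) hA

/-- A lower bound for the probability that the first `n` obligors behave, on average, as
prescribed by an almost optimal weight. -/
theorem eventually_le_measure_near [IsProbabilityMeasure P]
    (hUm : ∀ k, Measurable (U k)) (hτm : ∀ k, Measurable (τ k))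
    (hgrid : ∀ᵐ ω ∂P, ∀ k, τ k ω ∈ Finset.Icc 1 N)
    (hVi : iIndepFun (fun k ω => (U k ω, τ k ω)) P)
    (hVd : ∀ k, IdentDistrib (fun ω => (U k ω, τ k ω)) (fun ω => (U 0 ω, τ 0 ω)) P P)
    (hUτ : IndepFun (U 0) (τ 0) P) {φ d : Fin N → ℝ} (hφ : φ ∈ stdSimplex ℝ (Fin N)) {r : ℝ}
    (h : ∑ i, rateTerm (fenchelLegendre P (U 0)) (defaultDist P N (τ 0) i) (φ i) (d i) < r)
    {δ : ℝ} (hδ : 0 < δ) :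
    ∀ᶠ n : ℕ in atTop, 2⁻¹ * Real.exp (-(n * r))
      ≤ P.real {ω | ∀ i : Fin N, |gridLoss U τ n ω i - d i| < δ} := by
  have hp : ∀ i, defaultDist P N (τ 0) i ≠ ⊤ := fun i => measure_ne_top _ _
  -- The slack `r - r'` pays for the deviations of size `ε` from `(φ, d)` in the exponent, at cost
  -- at most `ε S`.
  obtain ⟨r', hr', hrr'⟩ := EReal.exists_between_coe_real h
  rw [EReal.coe_lt_coe_iff] at hrr'
  obtain ⟨s, hs, hsr⟩ := exists_lt_coe_of_sum_lt_coe Finset.univ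
    (fun i => rateTerm_ne_bot (hUm 0) (hp i) (hφ.1 i) (d i)) hr'
  choose g B b θ g1 g2 g3 g4 g5 g6 g7 g8 using fun i =>
    exists_weight (hUm 0) (hp i) (hφ.1 i) (hs i (Finset.mem_univ i))
  set V : ℕ → Ω → ℝ × ℕ := fun k ω => (U k ω, τ k ω) with hVdef
  have hV : ∀ k, Measurable (V k) := fun k => (hUm k).prodMk (hτm k)
  set W : ℝ × ℕ → ℝ := fun e => ∑ i : Fin N, gridInd i e * g i e.1 with hWdef
  have hgm : ∀ i, Measurable fun e : ℝ × ℕ => g i e.1 := fun i => (g1 i).comp measurable_fst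
  have hW : Measurable W :=
    Finset.measurable_sum _ fun i _ => (measurable_gridInd i).mul (hgm i)
  have hW0 : ∀ e, 0 ≤ W e := fun e =>
    Finset.sum_nonneg fun i _ => mul_nonneg (gridInd_nonneg i e) (g2 i _)
  have hB : ∀ i, 0 ≤ B i := fun i => (g2 i 0).trans (g3 i 0)
  have hind : ∀ (i : Fin N) e, gridInd i e ≤ 1 := fun i e => by
    unfold gridInd; split_ifs <;> norm_num
  set A₀ : ℝ := ∑ i, B i with hA₀
  have hA₀0 : 0 ≤ A₀ := Finset.sum_nonneg fun i _ => hB i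
  have hWA : ∀ e, W e ≤ A₀ := fun e => Finset.sum_le_sum fun i _ =>
    (mul_le_of_le_one_left (g2 i _) (hind i e)).trans (g3 i _)
  have hWs : ∀ e, W e ≠ 0 → |e.1| ≤ A₀ := by
    intro e he
    by_contra! hcon
    refine he (Finset.sum_eq_zero fun i _ => ?_)
    rw [g4 i _ ((Finset.single_le_sum (fun j _ => hB j) (Finset.mem_univ i)).trans_lt hcon),
      mul_zero]
  have hWind : ∀ (i : Fin N) e, W e * gridInd i e = gridInd i e * g i e.1 := by
    intro i e
    by_cases hi : e.2 = (i : ℕ) + 1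
    · rw [hWdef]
      simp only
      rw [sum_gridInd_mul hi fun j => g j e.1, mul_comm]
    · simp [gridInd, hi]
  have intW : ∀ (Y : ℝ × ℕ → ℝ), Measurable Y → ∀ A, (∀ e, W e ≠ 0 → |Y e| ≤ A) → ∀ j,
      Integrable (fun ω => W (V 0 ω) * Y (V 0 ω) ^ j) P := fun Y hY A hYA j =>
    integrable_weight_mul_pow (hV 0) hW hY (A := max A₀ A) hW0
      (fun e => (hWA e).trans (le_max_left _ _))
      (fun e he => (hYA e he).trans (le_max_right _ _)) j
  have i0 : Integrable (fun ω => W (V 0 ω)) P := by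
    simpa using intW 0 measurable_zero 0 (by simp) 0
  have intg : ∀ i, Integrable (fun ω => gridInd i (V 0 ω) * g i (U 0 ω)) P := by
    intro i
    have := intW (gridInd i) (measurable_gridInd i) 1 (fun e _ => by
      rw [abs_of_nonneg (gridInd_nonneg i e)]; exact hind i e) 1
    simp only [pow_one, hWind] at this
    exact this
  have eg : ∀ i, ∫ ω, gridInd i (V 0 ω) * g i (U 0 ω) ∂P = φ i := fun i =>
    (integral_gridInd_mul (hUm 0) (hτm 0) hUτ (g1 i) i).trans (g5 i)
  have h0 : ∫ ω, W (V 0 ω) ∂P = 1 := by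
    have : ∫ ω, W (V 0 ω) ∂P = ∑ i, ∫ ω, gridInd i (V 0 ω) * g i (U 0 ω) ∂P :=
      integral_finsetSum _ fun i _ => intg i
    rw [this, Finset.sum_congr rfl fun i _ => eg i, hφ.2]
  -- the two families of centred observables
  set Yc : Fin N → ℝ × ℕ → ℝ := fun i e => gridInd i e - φ i with hYc
  set Yl : Fin N → ℝ × ℕ → ℝ := fun i e => gridInd i e * e.1 - d i with hYl
  have mc : ∀ i, Measurable (Yc i) := fun i => (measurable_gridInd i).sub_const _
  have ml : ∀ i, Measurable (Yl i) := fun i =>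
    ((measurable_gridInd i).mul measurable_fst).sub_const _
  have bc : ∀ i e, W e ≠ 0 → |Yc i e| ≤ 1 + |φ i| := fun i e _ =>
    (abs_sub _ _).trans (by
      rw [abs_of_nonneg (gridInd_nonneg i e)]; linarith [hind i e])
  have bl : ∀ i e, W e ≠ 0 → |Yl i e| ≤ A₀ + |d i| := fun i e he =>
    (abs_sub _ _).trans (by
      rw [abs_mul, abs_of_nonneg (gridInd_nonneg i e)]
      have := mul_le_mul (hind i e) (hWs e he) (abs_nonneg _) zero_le_one
      linarith)
  have ec : ∀ i, ∫ ω, W (V 0 ω) * Yc i (V 0 ω) ∂P = 0 := by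
    intro i
    have e : ∀ ω, W (V 0 ω) * Yc i (V 0 ω)
        = gridInd i (V 0 ω) * g i (U 0 ω) - φ i * W (V 0 ω) := by
      intro ω; simp only [hYc, mul_sub, hWind]; ring
    simp_rw [e]
    rw [integral_sub (intg i) (i0.const_mul _), integral_const_mul, eg, h0]; ring
  have el : ∀ i, ∫ ω, W (V 0 ω) * Yl i (V 0 ω) ∂P = 0 := by
    intro i
    have e : ∀ ω, W (V 0 ω) * Yl i (V 0 ω)
        = gridInd i (V 0 ω) * (U 0 ω * g i (U 0 ω)) - d i * W (V 0 ω) := by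
      intro ω
      simp only [hYl, mul_sub, ← mul_assoc, hWind]
      simp only [hVdef]; ring
    have il : Integrable (fun ω => gridInd i (V 0 ω) * (U 0 ω * g i (U 0 ω))) P := by
      have h1 := (intW (Yl i) (ml i) _ (bl i) 1).add (i0.const_mul (d i))
      refine h1.congr (ae_of_all _ fun ω => ?_)
      simp only [Pi.add_apply, pow_one, e]; ring
    simp_rw [e]
    rw [integral_sub il (i0.const_mul _), integral_const_mul, h0,
      integral_gridInd_mul (hUm 0) (hτm 0) hUτ (h := fun u => u * g i u)
        (measurable_id.mul (g1 i)) i, g6]; ring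
  have chebyshev : ∀ (Y : ℝ × ℕ → ℝ), Measurable Y → ∀ A, (∀ e, W e ≠ 0 → |Y e| ≤ A) →
      ∫ ω, W (V 0 ω) * Y (V 0 ω) ∂P = 0 → ∀ {ε : ℝ}, 0 < ε → ∀ {n : ℕ}, 0 < n →
      ∫ ω in {ω | ε * n ≤ |∑ k ∈ Finset.range n, Y (V k ω)|}, ∏ k ∈ Finset.range n, W (V k ω) ∂P
      ≤ (∫ ω, W (V 0 ω) * Y (V 0 ω) ^ 2 ∂P) / ε ^ 2 / n := fun Y hY A hYA hY0 ε hε n hn =>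
    setIntegral_weighted_le hV hVi hVd hW hY hW0 i0 (by simpa using intW Y hY A hYA 1)
      (intW Y hY A hYA 2) h0 hY0 hε hn
  set S : ℝ := ∑ i, (|b i| + |θ i|) with hS
  have hS0 : 0 ≤ S := Finset.sum_nonneg fun i _ => by positivity
  set ε : ℝ := min δ ((r - r') / (S + 1)) with hε
  have hε0 : 0 < ε := lt_min hδ (div_pos (by linarith) (by linarith))
  have hεS : ε * S ≤ r - r' := by
    have h1 : ε * (S + 1) ≤ r - r' := by
      rw [← le_div_iff₀ (by linarith)]; exact min_le_right _ _
    nlinarith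
  set C : ℝ := ∑ i, ((∫ ω, W (V 0 ω) * Yc i (V 0 ω) ^ 2 ∂P) / ε ^ 2
    + (∫ ω, W (V 0 ω) * Yl i (V 0 ω) ^ 2 ∂P) / ε ^ 2) with hC
  have hlim : ∀ᶠ n : ℕ in atTop, C / n < 2⁻¹ :=
    (tendsto_const_div_atTop_nhds_zero_nat C).eventually (gt_mem_nhds (by norm_num))
  filter_upwards [hlim, eventually_gt_atTop 0] with n hnC hn
  have hn' : (0 : ℝ) < n := by exact_mod_cast hn
  obtain ⟨⟨iP, eP⟩, -, -⟩ := integral_weighted hV hVi hVd hW measurable_zero i0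
    (by simp) (by simp) h0 (by simp) n
  set w : Ω → ℝ := fun ω => ∏ k ∈ Finset.range n, W (V k ω) with hw
  have w_nonneg : ∀ ω, 0 ≤ w ω := fun ω => Finset.prod_nonneg fun k _ => hW0 _
  set G : Set Ω := {ω | ∀ i : Fin N, |gridLoss U τ n ω i - d i| < δ} with hG
  set Bc : Fin N → Set Ω := fun i => {ω | ε * n ≤ |∑ k ∈ Finset.range n, Yc i (V k ω)|} with hBc
  set Bl : Fin N → Set Ω := fun i => {ω | ε * n ≤ |∑ k ∈ Finset.range n, Yl i (V k ω)|} with hBl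
  have mBc : ∀ i, MeasurableSet (Bc i) := fun i => by
    have := fun k => (mc i).comp (hV k)
    exact measurableSet_le measurable_const (Finset.measurable_sum _ fun k _ => this k).abs
  have mBl : ∀ i, MeasurableSet (Bl i) := fun i => by
    have := fun k => (ml i).comp (hV k)
    exact measurableSet_le measurable_const (Finset.measurable_sum _ fun k _ => this k).abs
  have mG : MeasurableSet G := by
    rw [hG]
    simp only [Set.ofPred_forall]
    refine MeasurableSet.iInter fun i => measurableSet_lt (Measurable.abs ?_) measurable_const
    refine Measurable.sub_const (Measurable.div_const (Finset.measurable_sum _ fun k _ => ?_) _) _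
    exact ((measurable_gridInd i).comp (hV k)).mul (hUm k)
  have expand_c : ∀ i ω, ∑ k ∈ Finset.range n, Yc i (V k ω) = n * (gridFreq U τ n ω i - φ i) := by
    intro i ω
    simp only [hYc, Finset.sum_sub_distrib, gridFreq, Finset.sum_const, Finset.card_range,
      nsmul_eq_mul]
    field_simp; rfl
  have expand_l : ∀ i ω, ∑ k ∈ Finset.range n, Yl i (V k ω) = n * (gridLoss U τ n ω i - d i) := by
    intro i ω
    simp only [hYl, Finset.sum_sub_distrib, gridLoss, Finset.sum_const, Finset.card_range,
      nsmul_eq_mul]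
    field_simp; rfl
  -- the pointwise estimate
  have pointwise : ∀ᵐ ω ∂P, w ω ≤ G.indicator (fun _ => Real.exp (n * r)) ω
      + ∑ i, ((Bc i).indicator w ω + (Bl i).indicator w ω) := by
    filter_upwards [hgrid] with ω hω
    have hsum0 : ∀ i, 0 ≤ (Bc i).indicator w ω + (Bl i).indicator w ω := fun i =>
      add_nonneg (Set.indicator_nonneg (fun ω _ => w_nonneg ω) ω)
        (Set.indicator_nonneg (fun ω _ => w_nonneg ω) ω)
    by_cases hbad : ∃ i, ω ∈ Bc i ∨ ω ∈ Bl i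
    · obtain ⟨i, hi⟩ := hbad
      have h1 : w ω ≤ (Bc i).indicator w ω + (Bl i).indicator w ω := by
        rcases hi with hi | hi
        · rw [Set.indicator_of_mem hi]
          linarith [Set.indicator_nonneg (s := Bl i) (fun ω _ => w_nonneg ω) ω]
        · rw [Set.indicator_of_mem hi]
          linarith [Set.indicator_nonneg (s := Bc i) (fun ω _ => w_nonneg ω) ω]
      refine h1.trans ((Finset.single_le_sum (fun j _ => hsum0 j) (Finset.mem_univ i)).trans ?_)
      exact le_add_of_nonneg_left (Set.indicator_nonneg (fun _ _ => (Real.exp_pos _).le) ω)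
    · push Not at hbad
      have hc : ∀ i, |gridFreq U τ n ω i - φ i| < ε := by
        intro i
        have := (hbad i).1
        simp only [hBc, Set.mem_ofPred_eq, expand_c, not_le, abs_mul, abs_of_pos hn'] at this
        nlinarith
      have hl : ∀ i, |gridLoss U τ n ω i - d i| < ε := by
        intro i
        have := (hbad i).2
        simp only [hBl, Set.mem_ofPred_eq, expand_l, not_le, abs_mul, abs_of_pos hn'] at this
        nlinarith
      have hωG : ω ∈ G := fun i => (hl i).trans_le (min_le_left _ _)
      rw [Set.indicator_of_mem hωG]
      refine le_add_of_le_of_nonneg ?_ (Finset.sum_nonneg fun i _ => hsum0 i)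
      have h1 : w ω ≤ Real.exp (∑ k ∈ Finset.range n,
          ∑ i : Fin N, gridInd i (U k ω, τ k ω) * (b i + θ i * U k ω)) := by
        rw [Real.exp_sum]
        refine Finset.prod_le_prod (fun k _ => hW0 _) fun k _ => ?_
        obtain ⟨i, hi⟩ := exists_fin_of_mem_grid (hω k)
        rw [sum_gridInd_mul (e := (U k ω, τ k ω)) hi fun j => b j + θ j * U k ω]
        refine le_trans (le_of_eq ?_) (g7 i (U k ω))
        exact sum_gridInd_mul (e := (U k ω, τ k ω)) hi fun j => g j (U k ω)
      refine h1.trans (Real.exp_le_exp.2 ?_)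
      have h2 : ∑ k ∈ Finset.range n, ∑ i : Fin N, gridInd i (U k ω, τ k ω) * (b i + θ i * U k ω)
          = n * ∑ i, (b i * gridFreq U τ n ω i + θ i * gridLoss U τ n ω i) := by
        rw [Finset.sum_add_distrib, sum_gridFreq_mul, sum_gridLoss_mul]
        simp only [mul_add, Finset.sum_add_distrib]
        field_simp
      rw [h2]
      refine mul_le_mul_of_nonneg_left ?_ hn'.le
      have h3 : ∀ i, b i * gridFreq U τ n ω i + θ i * gridLoss U τ n ω i
          ≤ s i + ε * (|b i| + |θ i|) := by
        intro i
        have e1 : b i * (gridFreq U τ n ω i - φ i) ≤ |b i| * ε :=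
          (le_abs_self _).trans (by
            rw [abs_mul]; exact mul_le_mul_of_nonneg_left (hc i).le (abs_nonneg _))
        have e2 : θ i * (gridLoss U τ n ω i - d i) ≤ |θ i| * ε :=
          (le_abs_self _).trans (by
            rw [abs_mul]; exact mul_le_mul_of_nonneg_left (hl i).le (abs_nonneg _))
        have e3 := g8 i
        linarith
      calc ∑ i, (b i * gridFreq U τ n ω i + θ i * gridLoss U τ n ω i)
          ≤ ∑ i, (s i + ε * (|b i| + |θ i|)) := Finset.sum_le_sum fun i _ => h3 i
        _ = ∑ i, s i + ε * S := by rw [Finset.sum_add_distrib, ← Finset.mul_sum]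
        _ ≤ r := by linarith
  have iG : Integrable (G.indicator fun _ => Real.exp (n * r)) P :=
    (integrable_const _).indicator mG
  have iB : ∀ i, Integrable (fun ω => (Bc i).indicator w ω + (Bl i).indicator w ω) P := fun i =>
    (iP.indicator (mBc i)).add (iP.indicator (mBl i))
  have h1 := integral_mono_ae iP (iG.add (integrable_finsetSum Finset.univ fun i _ => iB i))
    pointwise
  have h2 : ∫ ω, (G.indicator (fun _ => Real.exp (n * r)) + fun ω =>
      ∑ i, ((Bc i).indicator w ω + (Bl i).indicator w ω)) ω ∂P
      ≤ P.real G * Real.exp (n * r) + C / n := by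
    simp only [Pi.add_apply]
    rw [integral_add iG (integrable_finsetSum Finset.univ fun i _ => iB i),
      integral_finsetSum _ fun i _ => iB i, integral_indicator mG, setIntegral_const, smul_eq_mul,
      hC, Finset.sum_div]
    gcongr with i _
    rw [integral_add (iP.indicator (mBc i)) (iP.indicator (mBl i)), integral_indicator (mBc i),
      integral_indicator (mBl i), add_div]
    exact add_le_add (chebyshev _ (mc i) _ (bc i) (ec i) hε0 hn)
      (chebyshev _ (ml i) _ (bl i) (el i) hε0 hn)
  have h3 : (1 : ℝ) ≤ P.real G * Real.exp (n * r) + C / n := by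
    rw [← eP]; exact h1.trans h2
  have h4 : 2⁻¹ ≤ P.real G * Real.exp (n * r) := by
    have : (2⁻¹ : ℝ) + 2⁻¹ = 1 := by norm_num
    linarith
  calc 2⁻¹ * Real.exp (-(n * r)) ≤ (P.real G * Real.exp (n * r)) * Real.exp (-(n * r)) :=
        mul_le_mul_of_nonneg_right h4 (Real.exp_pos _).le
    _ = P.real G := by rw [mul_assoc, ← Real.exp_add]; simp

/-- Telescoping: coordinate `i` is a sum of `i + 1` increments. -/
theorem abs_sub_lt_of_increment {x y : Fin N → ℝ} {δ : ℝ}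
    (h : ∀ i, |increment y i - increment x i| < δ) (i : Fin N) :
    |y i - x i| < ((i : ℕ) + 1) * δ := by
  obtain ⟨m, hm⟩ := i
  induction m with
  | zero => simpa [increment] using h ⟨0, hm⟩
  | succ m ih =>
    have h1 := ih (by omega)
    have h2 := h ⟨m + 1, hm⟩
    simp only [increment, Nat.add_eq_zero_iff, one_ne_zero, and_false, if_false,
      Nat.add_sub_cancel] at h2
    push_cast at h1 ⊢
    rw [abs_lt] at *
    constructor <;> nlinarith [h1.1, h1.2, h2.1, h2.2]

end LowerBound

end LossLDP

namespace LossLDP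

/-! ### Exponential moments -/

section Moments

variable {Ω : Type*} [MeasurableSpace Ω] {P : Measure Ω} {N : ℕ}

theorem exp_coe_mul_natCast (a : ℝ) (n : ℕ) :
    EReal.exp ((a : EReal) * n) = ENNReal.ofReal (Real.exp (n * a)) := by
  have : ((a : EReal) * n) = ((n * a : ℝ) : EReal) := by
    rw [mul_comm (n : ℝ) a, EReal.coe_mul]; rfl
  rw [this, EReal.exp_coe]

/-- A random variable whose tail decays superexponentially along the integers has exponential
moments. -/
theorem emgf_ne_top_of_tail [IsProbabilityMeasure P] {X : Ω → ℝ} (hX : Measurable X)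
    (hX0 : ∀ ω, 0 ≤ X ω)
    (h : ∀ a : ℝ, ∀ᶠ n : ℕ in atTop, P {ω | (n : ℝ) ≤ X ω} ≤ ENNReal.ofReal (Real.exp (n * a)))
    (θ : ℝ) : emgf P X θ ≠ ⊤ := by
  set b : ℝ := |θ| with hb
  have hb0 : 0 ≤ b := abs_nonneg θ
  -- Decay at rate `b + 1` beats the growth `e^{bn}` and leaves a geometric series of ratio
  -- `e^{-1}`. The factor `e^{m(b+1)}` below covers `n < m`.
  obtain ⟨m, hm⟩ := eventually_atTop.1 (h (-(b + 1)))
  have hbound : ∀ n : ℕ, P {ω | (n : ℝ) ≤ X ω}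
      ≤ ENNReal.ofReal (Real.exp (m * (b + 1) - n * (b + 1))) := by
    intro n
    rcases le_total m n with hmn | hmn
    · refine (hm n hmn).trans (ENNReal.ofReal_le_ofReal (Real.exp_le_exp.2 ?_))
      have : (0 : ℝ) ≤ m * (b + 1) := by positivity
      linarith
    · refine prob_le_one.trans ?_
      rw [ENNReal.one_le_ofReal, Real.one_le_exp_iff]
      have : (n : ℝ) ≤ m := by exact_mod_cast hmn
      nlinarith
  have hmeas : ∀ n : ℕ, MeasurableSet {ω | (n : ℝ) ≤ X ω} := fun n =>
    measurableSet_le measurable_const hX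
  have hpt : ∀ ω, ENNReal.ofReal (Real.exp (θ * X ω)) ≤ ∑' n : ℕ,
      {ω | (n : ℝ) ≤ X ω}.indicator (fun _ => ENNReal.ofReal (Real.exp (b * (n + 1)))) ω := by
    intro ω
    refine le_trans ?_ (ENNReal.le_tsum ⌊X ω⌋₊)
    rw [Set.indicator_of_mem (show ω ∈ {ω' | ((⌊X ω⌋₊ : ℕ) : ℝ) ≤ X ω'} from
      Nat.floor_le (hX0 ω))]
    refine ENNReal.ofReal_le_ofReal (Real.exp_le_exp.2 ?_)
    calc θ * X ω ≤ b * X ω := mul_le_mul_of_nonneg_right (le_abs_self θ) (hX0 ω)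
      _ ≤ b * (⌊X ω⌋₊ + 1) := mul_le_mul_of_nonneg_left (Nat.lt_floor_add_one _).le hb0
  have hterm : ∀ n : ℕ, ENNReal.ofReal (Real.exp (b * (n + 1))) * P {ω | (n : ℝ) ≤ X ω}
      ≤ ENNReal.ofReal (Real.exp (b + m * (b + 1))) * ENNReal.ofReal (Real.exp (-1)) ^ n := by
    intro n
    refine (mul_le_mul_right (hbound n) _).trans (le_of_eq ?_)
    rw [← ENNReal.ofReal_pow (Real.exp_pos _).le, ← Real.exp_nat_mul,
      ← ENNReal.ofReal_mul (Real.exp_pos _).le, ← ENNReal.ofReal_mul (Real.exp_pos _).le,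
      ← Real.exp_add, ← Real.exp_add]
    ring_nf
  have hlt : ENNReal.ofReal (Real.exp (-1)) < 1 := by
    rw [ENNReal.ofReal_lt_one, Real.exp_lt_one_iff]; norm_num
  refine ne_top_of_le_ne_top ?_ (calc emgf P X θ
      ≤ ∫⁻ ω, (∑' n : ℕ, {ω | (n : ℝ) ≤ X ω}.indicator
          (fun _ => ENNReal.ofReal (Real.exp (b * (n + 1)))) ω) ∂P := lintegral_mono hpt
    _ = ∑' n : ℕ, ENNReal.ofReal (Real.exp (b * (n + 1))) * P {ω | (n : ℝ) ≤ X ω} := by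
        rw [lintegral_tsum fun n => (measurable_const.indicator (hmeas n)).aemeasurable]
        exact tsum_congr fun n => lintegral_indicator_const (hmeas n) _
    _ ≤ ∑' n : ℕ, ENNReal.ofReal (Real.exp (b + m * (b + 1)))
          * ENNReal.ofReal (Real.exp (-1)) ^ n := ENNReal.tsum_le_tsum hterm
    _ = ENNReal.ofReal (Real.exp (b + m * (b + 1)))
          * (1 - ENNReal.ofReal (Real.exp (-1)))⁻¹ := by
        rw [ENNReal.tsum_mul_left, ENNReal.tsum_geometric])
  exact ENNReal.mul_ne_top ENNReal.ofReal_ne_top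
    (ENNReal.inv_ne_top.2 (tsub_pos_of_lt hlt).ne')

/-- The point of the simplex that puts mass `t` on the first and `1 - t` on the second
coordinate. -/
def edgePoint (N : ℕ) (t : ℝ) (i : Fin N) : ℝ :=
  if (i : ℕ) = 0 then t else if (i : ℕ) = 1 then 1 - t else 0

theorem edgePoint_mem_stdSimplex (hN : 2 ≤ N) {t : ℝ} (h0 : 0 ≤ t) (h1 : t ≤ 1) :
    edgePoint N t ∈ stdSimplex ℝ (Fin N) := by
  refine ⟨fun i => ?_, ?_⟩
  · unfold edgePoint; split_ifs <;> linarith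
  · obtain ⟨M, rfl⟩ := Nat.exists_eq_add_of_le' hN
    rw [Fin.sum_univ_succ, Fin.sum_univ_succ]
    simp [edgePoint]

theorem cumul_edgePoint (hN : 2 ≤ N) (t : ℝ) : cumul (edgePoint N t) ⟨0, by omega⟩ = t := by
  have : Finset.Iic (⟨0, by omega⟩ : Fin N) = {⟨0, by omega⟩} := by
    ext j; simp [Fin.le_def, Fin.ext_iff]
  rw [cumul, this, Finset.sum_singleton]
  simp [edgePoint]

theorem tendsto_edgePoint : Tendsto (fun n : ℕ => edgePoint N (1 / (n : ℝ))) atTop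
    (𝓝 (edgePoint N 0)) := by
  have hc : Continuous (edgePoint N) := by
    refine continuous_pi fun i => ?_
    unfold edgePoint
    split_ifs <;> fun_prop
  exact (hc.tendsto 0).comp tendsto_one_div_atTop_nhds_zero_nat

theorem measurable_roundedSums {U : ℕ → Ω → ℝ} (hUm : ∀ k, Measurable (U k)) (φ : Fin N → ℝ)
    (n : ℕ) : Measurable (roundedSums U φ n) :=
  measurable_pi_lambda _ fun _ => (Finset.measurable_sum _ fun k _ => hUm k).div_const _

/-- For mass `0` and mass `1/n` at the first grid point, the first rounded sums contain no term and
exactly one term. Under any coupling, `U_0 ≥ n` therefore forces distance at least 1. -/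
theorem emgf_ne_top_of_expEquivalent [IsProbabilityMeasure P] (hN : 2 ≤ N) {U : ℕ → Ω → ℝ}
    (hUm : ∀ k, Measurable (U k)) (hU : ∀ k ω, 0 ≤ U k ω)
    (hexp : RoundedSumsExpEquivalent P N U) (θ : ℝ) : emgf P (U 0) θ ≠ ⊤ := by
  refine emgf_ne_top_of_tail (hUm 0) (hU 0) (fun a => ?_) θ
  obtain ⟨γ, hγ1, hγ2, hγ⟩ := hexp (edgePoint N 0)
    (edgePoint_mem_stdSimplex hN le_rfl zero_le_one) (fun n => edgePoint N (1 / (n : ℝ)))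
    (fun n => edgePoint_mem_stdSimplex hN (by positivity) (by
      -- At `n = 0` the convention `1 / 0 = 0` keeps the point in the simplex.
      rcases n.eq_zero_or_pos with rfl | hn
      · simp
      · rw [div_le_one (by exact_mod_cast hn)]; exact_mod_cast hn)) tendsto_edgePoint
  have h1 : ExpGrowth.expGrowthSup (fun n => γ n {z | (1 : ℝ) ≤ dist z.1 z.2}) < (a : EReal) :=
    (hγ 1 one_pos).trans_lt (EReal.bot_lt_coe a)
  filter_upwards [ExpGrowth.eventually_le_exp h1, eventually_gt_atTop 0] with n hn hn0
  rw [exp_coe_mul_natCast] at hn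
  refine le_trans ?_ hn
  have hn' : (0 : ℝ) < n := by exact_mod_cast hn0
  set o : Fin N := ⟨0, by omega⟩ with ho
  have e1 : γ n {z | z.1 o ≠ 0} = 0 := by
    have hm : MeasurableSet {v : Fin N → ℝ | v o ≠ 0} :=
      measurableSet_eq_fun (measurable_pi_apply o) measurable_const |>.compl
    change γ n (Prod.fst ⁻¹' {v : Fin N → ℝ | v o ≠ 0}) = 0
    rw [← Measure.map_apply measurable_fst hm, hγ1,
      Measure.map_apply (measurable_roundedSums hUm _ n) hm]
    convert measure_empty (μ := P)
    refine Set.eq_empty_of_forall_notMem fun ω hω => hω ?_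
    simp [roundedSums, ho, cumul_edgePoint hN]
  have e2 : γ n {z | 1 ≤ z.2 o} = P {ω | (n : ℝ) ≤ U 0 ω} := by
    have hm : MeasurableSet {v : Fin N → ℝ | 1 ≤ v o} :=
      measurableSet_le measurable_const (measurable_pi_apply o)
    change γ n (Prod.snd ⁻¹' {v : Fin N → ℝ | 1 ≤ v o}) = _
    rw [← Measure.map_apply measurable_snd hm, hγ2,
      Measure.map_apply (measurable_roundedSums hUm _ n) hm]
    congr 1
    ext ω
    change 1 ≤ roundedSums U _ n ω o ↔ (n : ℝ) ≤ U 0 ω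
    simp only [roundedSums, ho, cumul_edgePoint hN]
    rw [mul_one_div_cancel hn'.ne', Nat.floor_one, Finset.sum_range_one, one_le_div hn']
  rw [← e2]
  calc γ n {z | 1 ≤ z.2 o} ≤ γ n ({z | 1 ≤ dist z.1 z.2} ∪ {z | z.1 o ≠ 0}) := by
        refine measure_mono fun z hz => ?_
        by_cases h0 : z.1 o = 0
        · left
          have hd := dist_le_pi_dist z.1 z.2 o
          rw [Real.dist_eq, h0, zero_sub, abs_neg] at hd
          exact (show (1 : ℝ) ≤ z.2 o from hz).trans ((le_abs_self _).trans hd)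
        · right; exact h0
    _ ≤ _ := (measure_union_le _ _).trans (by rw [e1, add_zero])

/-- Without positive exponential moments the Fenchel–Legendre transform vanishes at infinity. -/
theorem exists_forall_fenchelLegendre_le [IsProbabilityMeasure P] {X : Ω → ℝ} (hX : Measurable X)
    (h : ∀ θ : ℝ, 0 < θ → emgf P X θ = ⊤) {ε : ℝ} (hε : 0 < ε) :
    ∃ K : ℝ, ∀ x, K ≤ x → fenchelLegendre P X x ≤ ε := by
  have hmono : Monotone fun n : ℕ => {ω | X ω ≤ n} := fun m n hmn ω hω =>
    le_trans (show X ω ≤ m from hω) (by exact_mod_cast hmn)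
  have hlim := tendsto_measure_iUnion_atTop (μ := P) hmono
  have hu : (⋃ n : ℕ, {ω | X ω ≤ n}) = Set.univ :=
    Set.eq_univ_of_forall fun ω => Set.mem_iUnion.2 (exists_nat_ge (X ω))
  rw [hu, measure_univ] at hlim
  have hlt : ENNReal.ofReal (Real.exp (-ε)) < 1 := by
    rw [ENNReal.ofReal_lt_one, Real.exp_lt_one_iff]; linarith
  obtain ⟨n, hn⟩ := (hlim.eventually (lt_mem_nhds hlt)).exists
  have hS : MeasurableSet {ω | X ω ≤ n} := measurableSet_le hX measurable_const
  -- Positive `θ` contribute `-∞`. For `θ ≤ 0`, `M(θ) ≥ e^{θn} P(X ≤ n) ≥ e^{θn - ε}`, and `θx ≤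
  -- θn`.
  refine ⟨n, fun x hx => iSup_le fun θ => ?_⟩
  rcases lt_or_ge 0 θ with hθ | hθ
  · rw [logMGF_eq, h θ hθ, ENNReal.log_top, EReal.sub_top]; exact bot_le
  have h1 : ENNReal.ofReal (Real.exp (θ * n - ε)) ≤ emgf P X θ := by
    calc ENNReal.ofReal (Real.exp (θ * n - ε))
        = ENNReal.ofReal (Real.exp (θ * n)) * ENNReal.ofReal (Real.exp (-ε)) := by
          rw [← ENNReal.ofReal_mul (Real.exp_pos _).le, ← Real.exp_add, sub_eq_add_neg]
      _ ≤ ENNReal.ofReal (Real.exp (θ * n)) * P {ω | X ω ≤ n} := mul_le_mul_right hn.le _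
      _ = ∫⁻ ω, {ω | X ω ≤ n}.indicator (fun _ => ENNReal.ofReal (Real.exp (θ * n))) ω ∂P :=
          (lintegral_indicator_const hS _).symm
      _ ≤ emgf P X θ := lintegral_mono fun ω => by
          refine Set.indicator_le' (s := {ω | X ω ≤ n})
            (g := fun ω => ENNReal.ofReal (Real.exp (θ * X ω))) (fun ω hω => ?_)
            (fun _ _ => zero_le) ω
          exact ENNReal.ofReal_le_ofReal
            (Real.exp_le_exp.2 (mul_le_mul_of_nonpos_left hω hθ))
  have h2 : ((θ * n - ε : ℝ) : EReal) ≤ logMGF P X θ := by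
    have := ENNReal.log_monotone h1
    rwa [ENNReal.log_ofReal_of_pos (Real.exp_pos _), Real.log_exp] at this
  refine (EReal.sub_le_sub le_rfl h2).trans ?_
  rw [← EReal.coe_sub, EReal.coe_le_coe_iff]
  nlinarith

theorem rateFunction_le_fenchelLegendre {X : Ω → ℝ} {p : Fin 1 → ℝ≥0∞} (hp : ∑ i, p i = 1)
    (x : PathSpace 1) : rateFunction P X p x ≤ fenchelLegendre P X (x.1 0) := by
  have hp0 : p 0 = 1 := by simpa using hp
  refine (iInf₂_le (fun _ => 1) ⟨fun _ => zero_le_one, by simp⟩).trans (le_of_eq ?_)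
  simp [rateTerm, hp0, increment]

end Moments

end LossLDP

/-! ### Assembly of the large deviation principle -/

open LossLDP

theorem theorem3p1 {Ω : Type*} [MeasurableSpace Ω] (P : Measure Ω) [IsProbabilityMeasure P]
    (N : ℕ) (U : ℕ → Ω → ℝ) (τ : ℕ → Ω → ℕ)
    (hU_meas : ∀ k, Measurable (U k)) (hτ_meas : ∀ k, Measurable (τ k))
    (hU_nonneg : ∀ k ω, 0 ≤ U k ω)
    (hτ_grid : ∀ k, ∀ᵐ ω ∂P, τ k ω ∈ Finset.Icc 1 N)
    (hU_indep : iIndepFun U P) (hU_ident : ∀ k, IdentDistrib (U k) (U 0) P P)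
    (hτ_indep : iIndepFun τ P) (hτ_ident : ∀ k, IdentDistrib (τ k) (τ 0) P P)
    (hUτ_indep : IndepFun (fun ω k => U k ω) (fun ω k => τ k ω) P)
    (hexp : LossLDP.RoundedSumsExpEquivalent P N U) :
    LossLDP.SatisfiesLDP
      (fun n => P.map (LossLDP.avgLossPath N U τ hU_nonneg n))
      (LossLDP.rateFunction P (U 0) (LossLDP.defaultDist P N (τ 0))) := by
  have hgrid : ∀ᵐ ω ∂P, ∀ k, τ k ω ∈ Finset.Icc 1 N := ae_all_iff.2 hτ_grid
  have hUτ : ∀ k, IndepFun (U k) (τ k) P := fun k =>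
    hUτ_indep.comp (measurable_pi_apply k) (measurable_pi_apply k)
  have hVi := iIndepFun_prodMk hU_meas hτ_meas hU_indep hτ_indep hUτ_indep
  have hVd : ∀ k, IdentDistrib (fun ω => (U k ω, τ k ω)) (fun ω => (U 0 ω, τ 0 ω)) P P :=
    fun k => identDistrib_prodMk (hU_ident k) (hτ_ident k) (hUτ k) (hUτ 0)
  have hp := sum_defaultDist_eq_one (hτ_meas 0) (hτ_grid 0)
  have hM : ∀ φ ∈ stdSimplex ℝ (Fin N), ∀ i, 0 < φ i ∨ ∀ θ, emgf P (U 0) θ ≠ ⊤ := by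
    intro φ hφ i
    rcases lt_or_ge N 2 with hN | hN
    · have hN1 : N = 1 := by have := i.isLt; omega
      subst hN1
      left
      have h1 : φ 0 = 1 := by simpa using hφ.2
      rw [Subsingleton.elim i 0, h1]; exact one_pos
    · exact Or.inr (emgf_ne_top_of_expEquivalent hN hU_meas hU_nonneg hexp)
  have hL := measurable_avgLossPath (N := N) hU_meas hτ_meas hU_nonneg
  refine ⟨isRateFunction_rateFunction (hU_meas 0) hp hM, fun F hF => ?_, fun G hG => ?_⟩
  · rw [EReal.le_neg]
    refine EReal.ge_of_forall_gt_iff_ge.1 fun a ha => ?_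
    have haF : ∀ x ∈ F, (a : EReal) < rateFunction P (U 0) (defaultDist P N (τ 0)) x :=
      fun x hx => ha.trans_le (iInf₂_le x hx)
    have compact : ∀ {S : Set (PathSpace N)}, IsCompact S → S ⊆ F → _ := fun hS hSF =>
      measure_avgLossPath_mem_le_of_isCompact hU_meas hτ_meas hU_nonneg hgrid hVi hVd (hUτ 0) hM
        hS fun x hx => haF x (hSF hx)
    have key : ∃ C : ℝ≥0∞, C ≠ ⊤ ∧ ∀ n : ℕ, 0 < n → P {ω | avgLossPath N U τ hU_nonneg n ω ∈ F}
        ≤ C * ENNReal.ofReal (Real.exp (-(n * a))) := by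
      by_cases hθ : ∃ θ : ℝ, 0 < θ ∧ emgf P (U 0) θ ≠ ⊤
      · obtain ⟨θ, hθ, hMθ⟩ := hθ
        obtain ⟨R, hR⟩ := exists_measure_avgLossPath_gt_le (N := N) (τ := τ) hU_meas hU_nonneg
          hU_indep hU_ident hθ hMθ a
        obtain ⟨C, hC, h⟩ := compact ((isCompact_setOf_forall_le R).inter_left hF)
          Set.inter_subset_left
        refine ⟨C + 1, ENNReal.add_ne_top.2 ⟨hC, ENNReal.one_ne_top⟩, fun n hn => ?_⟩
        rw [add_mul, one_mul]
        refine le_trans (measure_mono fun ω hω => ?_)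
          ((measure_union_le _ _).trans (add_le_add (h n hn) (hR n hn)))
        by_cases hle : ∀ i, (avgLossPath N U τ hU_nonneg n ω).1 i ≤ R
        · exact Or.inl ⟨hω, hle⟩
        · exact Or.inr hle
      · push Not at hθ
        have hN1 : N = 1 := by
          have h0 : N ≠ 0 := by
            rintro rfl
            obtain ⟨ω, hω⟩ := (hτ_grid 0).exists
            simp at hω
          by_contra hN1
          exact emgf_ne_top_of_expEquivalent (by omega) hU_meas hU_nonneg hexp 1 (hθ 1 one_pos)
        by_cases hR : ∃ R : ℝ, F ⊆ {x | ∀ i, x.1 i ≤ R}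
        · obtain ⟨R, hR⟩ := hR
          exact compact ((isCompact_setOf_forall_le R).of_isClosed_subset hF hR) subset_rfl
        -- With `N = 1` and no positive exponential moment, an unbounded `F` contains points of
        -- arbitrarily small rate. Hence `a < 0`, and the bound reduces to probabilities being at
        -- most 1.
        · have ha0 : a < 0 := by
            by_contra! ha0
            obtain ⟨ε, hε1, hε2⟩ := EReal.exists_between_coe_real ha
            have hε : 0 < ε := ha0.trans_lt (EReal.coe_lt_coe_iff.1 hε1)
            obtain ⟨K, hK⟩ := exists_forall_fenchelLegendre_le (hU_meas 0) hθ hε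
            push Not at hR
            obtain ⟨x, hxF, hx⟩ := Set.not_subset.1 (hR K)
            simp only [Set.mem_ofPred_eq, not_forall, not_le] at hx
            obtain ⟨i, hi⟩ := hx
            subst hN1
            rw [Subsingleton.elim i 0] at hi
            exact absurd (hε2.trans_le ((iInf₂_le x hxF).trans
              (rateFunction_le_fenchelLegendre hp x))) (not_lt.2 (hK _ hi.le))
          refine ⟨1, ENNReal.one_ne_top, fun n hn => prob_le_one.trans ?_⟩
          rw [one_mul, ENNReal.one_le_ofReal, Real.one_le_exp_iff]
          have hn' : (0 : ℝ) < n := by exact_mod_cast hn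
          nlinarith
    obtain ⟨C, hC, h⟩ := key
    rw [EReal.le_neg]
    -- `expGrowthSup` unfolds to the limsup in the statement, and it ignores the finite factor `C`.
    have h1 : ExpGrowth.expGrowthSup (fun n => P.map (avgLossPath N U τ hU_nonneg n) F)
        ≤ ExpGrowth.expGrowthSup (fun n => EReal.exp (((-a : ℝ) : EReal) * n)) := by
      refine ExpGrowth.expGrowthSup_le_of_eventually_le hC ?_
      filter_upwards [eventually_gt_atTop 0] with n hn
      rw [exp_coe_mul_natCast, Measure.map_apply (hL n) hF.measurableSet, mul_neg]
      exact h n hn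
    rw [ExpGrowth.expGrowthSup_exp] at h1
    exact h1
  · rw [EReal.neg_le]
    refine le_iInf₂ fun x hx => le_iInf₂ fun φ hφ => ?_
    refine EReal.le_of_forall_lt_iff_le.1 fun r hr => ?_
    obtain ⟨ε, hε, hball⟩ := Metric.isOpen_iff.1 hG x hx
    -- At most `N` increment errors accumulate in a coordinate, so each may be `ε / (N + 1)`.
    have hδ : 0 < ε / (N + 1) := by positivity
    have hev := eventually_le_measure_near hU_meas hτ_meas hgrid hVi hVd (hUτ 0) hφ hr hδ
    rw [EReal.neg_le]
    have h1 : ExpGrowth.expGrowthInf (fun n => EReal.exp (((-r : ℝ) : EReal) * n))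
        ≤ ExpGrowth.expGrowthInf (fun n => P.map (avgLossPath N U τ hU_nonneg n) G) := by
      refine ExpGrowth.expGrowthInf_of_eventually_ge (b := ENNReal.ofReal 2⁻¹) (by simp) ?_
      filter_upwards [hev] with n hn
      rw [exp_coe_mul_natCast, Measure.map_apply (hL n) hG.measurableSet, mul_neg,
        ← ENNReal.ofReal_mul (by norm_num)]
      refine (ENNReal.ofReal_le_ofReal hn).trans ?_
      rw [ofReal_measureReal]
      refine measure_mono_ae ?_
      filter_upwards [hgrid] with ω hω h
      refine hball ?_
      rw [Metric.mem_ball, Subtype.dist_eq, dist_pi_lt_iff hε]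
      intro i
      rw [Real.dist_eq]
      have h2 := abs_sub_lt_of_increment (x := x.1)
        (y := (avgLossPath N U τ hU_nonneg n ω).1) (δ := ε / (N + 1))
        (fun j => by rw [increment_avgLossPath hU_nonneg hω]; exact h j) i
      refine h2.trans_le ?_
      rw [mul_div_assoc', div_le_iff₀ (by positivity)]
      have h3 : ((i : ℕ) : ℝ) ≤ N := by exact_mod_cast i.isLt.le
      nlinarith
    rw [ExpGrowth.expGrowthInf_exp] at h1
    exact h1
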